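/- **Setting.** Notation: $f(n)\ll g(n)$ means that there are $C>0$ and $n_0$ with $|f(n)|\le C g(n)$ for all $n>n_0$; $f\gg g$ means $g\ll f$; $f\asymp g$ means $f\ll g\ll f$. A measurable $r:\mathbb R^+\to\mathbb R^+$ is regularly varying with index $-\alpha\in\mathbb R$ if $\lim_{x\to\infty} r(\lambda x)/r(x)=\lambda^{-\alpha}$ for all $\lambda>0$. Let $(M,d)$ be a bounded metric space with a Borel probability measure $\mu_M$ and let $T:M\to M$ be a mixing measure preserving map satisfying the following conditions. **(C1)** $T$ has a two-sided Chernov–Markarian–Zhang structure, that is: there are Borel sets $\Delta_0\subset\hat M\subset M$ with $\mu_M(\Delta_0)>0$; every point of $\hat M$ returns to $\hat M$, and the first return time $R:\hat M\to\mathbb N^+$ is integrable. Let $\hat T=T^R:\hat M\to\hat M$ be the first return map and $\mu_{\hat M}$ the normalised restriction of $\mu_M$ to $\hat M$. There are $\sigma:\Delta_0\to\mathbb N^+$ and a probability measure $\mu_{\Delta_0}$ on $\Delta_0$ such that $\sigma$ is integrable, $F_0=\hat T^\sigma$ maps $\Delta_0$ to itself, and $F_0$ is a two-sided Gibbs–Markov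 map: it preserves $\mu_{\Delta_0}$ ergodically; there is a measure preserving semiconjugacy $\pi'$ from $F_0$ to a full-branch Gibbs–Markov map $F_0':\Delta_0'\to\Delta_0'$ (an ergodic measure preserving map of a probability space $(\Delta_0',\mu_{\Delta_0}')$ with a countable measurable partition $\mathcal P$ separating trajectories, each $F_0'|_A:A\to\Delta_0'$, $A\in\mathcal P$, being a measurable bijection, and with Jacobian $\xi=d\mu_{\Delta_0}'/d(\mu_{\Delta_0}'\circ F_0')$ satisfying $|\log\xi(x)-\log\xi(y)|\le C\theta^{s(x,y)}$ for $x,y\in A\in\mathcal P$, with $C>0$ and $\theta\in(0,1)$, where $s(x,y)\in\mathbb N\cup\{\infty\}$ is the first $n$ for which $F_0'^n x,F_0'^n y$ lie in different elements of $\mathcal P$); and, with $s(x,y)=s(\pi'x,\pi'y)$ for $x,y\in\Delta_0$, $d(F_0^nx,F_0^ny)\le C(\theta^n+\theta^{s(x,y)-n})$ for all $n\ge1$ and $x,y\in\Delta_0$, with some $C>0$, $\theta\in(0,1)$. The function $\sigma$ is constant on each $\pi'^{-1}A$, $A\in\mathcal P$, and $R$ is constant on $\hat T^\ell\pi'^{-1}A$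 for $0\le\ell<\sigma(A)$. For $h:\Delta_0\to\mathbb N^+$ the tower of height $h$ is $\Delta_0^h=\{(x,\ell):0\le\ell<h(x)\}$, with the map $(x,\ell)\mapsto(x,\ell+1)$ if $\ell+1<h(x)$ and $(x,\ell)\mapsto(F_0x,0)$ otherwise, and with base $\Delta_0\times\{0\}$, identified with $\Delta_0$. Let $(\hat\Delta,\hat F)$ be the tower of height $\sigma$, with the probability measure $\mu_{\hat\Delta}=(\mu_{\Delta_0}\times\text{counting})/\int\sigma\,d\mu_{\Delta_0}$; then $\pi:\hat\Delta\to\hat M$, $\pi(y,\ell)=\hat T^\ell y$, is required to map $\mu_{\hat\Delta}$ to $\mu_{\hat M}$. Let $(\Delta,F)$ be the tower of height $h(y)=\sum_{\ell<\sigma(y)}R(\hat T^\ell y)$. For $n\ge 0$ put $$D_n=\{\hat x\in\hat\Delta:\min\{j\ge1:\hat F^j\hat x\in\Delta_0\}>n\},\quad H_n=\{\hat x\in\hat\Delta: R(\pi\hat x)>n\},\quad A_n=\{x\in\Delta_0:\min\{j\ge1:F^jx\in\Delta_0\}>n\}.$$ Moreover $\mu_{\hat\Delta}(D_n)\ll\rho^n$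 for some $\rho\in(0,1)$, and there are $K>0$, $\gamma_0\in(0,1)$ such that for all $x,y\in\Delta_0$ and all $0\le\ell<\min\{j\ge1:T^jx\in\Delta_0\}$ one has $d(T^\ell x,T^\ell y)\le K(d(x,y)+\gamma_0^{s(x,y)})$ and, if $s(x,y)\ge1$, $d(T^\ell x,T^\ell y)\le K(d(x,y)+d(F_0x,F_0y))$. Put $R_k=\{x\in\hat M:R(x)=k+1\}$. **(C2)** There is a family $\mathcal U$ of curves in $\hat M$ (the standard curves; simple, of finite positive length, with arclength measure $m_\gamma$, end points disregarded) such that the $\hat T$-image of each $\gamma\in\mathcal U$ is, up to a set of $m_\gamma$-measure zero in $\gamma$, a countable family of pairwise disjoint curves $\gamma_j\in\mathcal U$. A standard pair $(\gamma,\nu)$ is a $\gamma\in\mathcal U$ with a probability measure $\nu\ll m_\gamma$ (absolutely continuous). The image of a standard pair consists of the pairs $(\gamma_j,\nu_j)$, where $w_j=\hat T_*\nu(\gamma_j)>0$ and $\nu_j=w_j^{-1}\hat T_*\nu|_{\gamma_j}$, and these are again standard pairs. A standard family $\mathcal G$ is a measurable family $(\gamma_i,\nu_i)_{i\in I}$ of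 standard pairs with a probability measure $\lambda$ on $I$; it induces $\mu_{\mathcal G}=\int\nu_i\,d\lambda(i)$. Its image $\hat T_*\mathcal G$ is the standard family formed by the image pairs of all its pairs, with the factor measure that gives the pieces of the $i$-th pair the conditional masses $w_j$. Put $$\mathcal Z(\mathcal G)=\sup_{\varepsilon>0}\frac1\varepsilon\,\mu_{\mathcal G}\Big(\bigcup_{i}\{x\in\gamma_i:0<r_i(x)<\varepsilon\}\Big),$$ where $r_i(x)$ is the length of the shorter of the two segments into which $x$ cuts $\gamma_i$. **(C3)** For every $k$ with $\mu_{\hat M}(R_k)>0$ there is a standard family $\mathcal G^{(k)}_0$ of pairwise disjoint curves contained in $R_k$ that induces the normalised restriction of $\mu_{\hat M}$ to $R_k$. Let $\mathcal G^{(k)}_{m+1}=\hat T_*\mathcal G^{(k)}_m$. The measures $\nu$ of the standard pairs $(\gamma,\nu)$ in all families $\mathcal G^{(k)}_m$, $m\ge1$, are uniformly equivalent to normalised arclength: there is $C>0$, independent of $k$, $m$ and the pair, with $C^{-1}m_\gamma/m_\gamma(\gamma)\le\nu\le C\,m_\gamma/m_\gamma(\gamma)$. There are real numbers $t\ge p>1$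 such that: **(C4)** $m_\gamma(\gamma\cap R_k)\ll k^{-t}$, uniformly in $\gamma\in\mathcal U$. **(C5)** $\mathcal Z(\mathcal G^{(k)}_m)\ll k^{t-p}$, uniformly in $m\ge1$ (for the $k$ with $\mu_{\hat M}(R_k)>0$). **Theorem.** Let $r$ be regularly varying (of any index) and $a>0$. Then (a) $\mu_{\hat\Delta}(H_n)\ll r(n)$ implies $\mu_{\Delta_0}(A_n)\ll r(n)$. (b) $\mu_{\hat\Delta}(H_n)\gg n^{-a}$ implies $\mu_{\Delta_0}(A_n)\gg\mu_{\hat\Delta}(H_n)$. (c) $\mu_{\hat\Delta}(H_n)\asymp r(n)$ implies $\mu_{\Delta_0}(A_n)\asymp r(n)$. -/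

import Mathlib

open Set Filter Topology MeasureTheory ProbabilityTheory
open scoped ENNReal

universe u v w

noncomputable section

/-! Regularly varying functions -/

/-- `r : ℝ⁺ → ℝ⁺` (a function on `ℝ` of which only the values on `(0, ∞)` matter) is measurable and
regularly varying with index `-α`. -/
structure IsRegularlyVarying (r : ℝ → ℝ) (α : ℝ) : Prop where
  measurable : Measurable ((Ioi (0 : ℝ)).domRestrict r)
  pos : ∀ x : ℝ, 0 < x → 0 < r x
  tendsto : ∀ l : ℝ, 0 < l → Tendsto (fun x => r (l * x) / r x) atTop (𝓝 (l ^ (-α)))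

/-! Hitting times and first return maps -/

/-- `min {n ≥ 1 | fⁿ x ∈ B}` (and `0` if there is no such `n`). For `x ∈ B` this is the first return
time of `B`. -/
def hitTime {X : Type*} (f : X → X) (B : Set X) (x : X) : ℕ :=
  sInf {n : ℕ | 1 ≤ n ∧ f^[n] x ∈ B}

/-- The first return map `x ↦ f^{R(x)} x` of `B`. -/
def firstReturn {X : Type*} (f : X → X) (B : Set X) (x : X) : X :=
  f^[hitTime f B x] x

/-- Mixing of a measure preserving transformation of a probability space. -/
structure IsMixing {X : Type*} [MeasurableSpace X] (f : X → X) (μ : Measure X) : Prop where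
  preserving : MeasurePreserving f μ μ
  mixing : ∀ A B : Set X, MeasurableSet A → MeasurableSet B →
    Tendsto (fun n : ℕ => μ (A ∩ f^[n] ⁻¹' B)) atTop (𝓝 (μ A * μ B))

/-! Gibbs-Markov maps -/

/-- The separation time `min {n | Fⁿ x and Fⁿ y lie in different elements of P}`, `∞` if there is no
such `n`. -/
def sepTime {Y : Type*} (F : Y → Y) (P : Set (Set Y)) (x y : Y) : ℕ∞ :=
  ⨅ n : ℕ, ⨅ _ : ∃ A ∈ P, F^[n] x ∈ A ∧ F^[n] y ∉ A, (n : ℕ∞)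

/-- `θ ^ s` for `s ∈ ℕ ∪ {∞}`, with `θ ^ ∞ = 0`. -/
def sepPow (θ : ℝ) (s : ℕ∞) : ℝ :=
  if s = ⊤ then 0 else θ ^ s.toNat

/-- A full-branch Gibbs-Markov map `F` of the probability space `(Y, m)` with countable partition
`P`. The function `ξ` is the Jacobian `dm / d(m ∘ F)`: on each `A ∈ P` the measure `m` has density
`ξ` with respect to `E ↦ m (F '' E)`. -/
structure IsGibbsMarkov {Y : Type*} [MeasurableSpace Y] (F : Y → Y) (m : Measure Y)
    (P : Set (Set Y)) : Prop where
  prob : IsProbabilityMeasure m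
  ergodic : Ergodic F m
  countable : P.Countable
  partition : Setoid.IsPartition P
  measurableSet : ∀ A ∈ P, MeasurableSet A
  separates : ∀ x y : Y, sepTime F P x y = ⊤ ↔ x = y
  full_branch : ∀ A ∈ P, MeasurableEmbedding (A.domRestrict F) ∧ range (A.domRestrict F) = univ
  distortion : ∃ ξ : Y → ℝ, Measurable ξ ∧ (∀ x, 0 < ξ x) ∧
    (∀ A ∈ P, m.comap (Subtype.val : A → Y) =
      (m.comap (A.domRestrict F)).withDensity (fun x => ENNReal.ofReal (ξ x))) ∧
    ∃ C θ : ℝ, 0 < C ∧ θ ∈ Ioo (0 : ℝ) 1 ∧ ∀ A ∈ P, ∀ x ∈ A, ∀ y ∈ A,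
      |Real.log (ξ x) - Real.log (ξ y)| ≤ C * sepPow θ (sepTime F P x y)

/-- A two-sided Gibbs-Markov map `F₀` of `(X, μ₀)`, with factor map `π'` onto the one-sided
Gibbs-Markov map `F'` of `(Y, m)` with partition `P`. Since `θ ^ (s - n)` may have a negative
exponent, it is written `θ ^ s / θ ^ n`. -/
structure IsTwoSidedGibbsMarkov {X : Type*} [MetricSpace X] [MeasurableSpace X]
    {Y : Type*} [MeasurableSpace Y] (F₀ : X → X) (μ₀ : Measure X)
    (F' : Y → Y) (m : Measure Y) (P : Set (Set Y)) (π' : X → Y) : Prop where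
  bounded : BoundedSpace X
  prob : IsProbabilityMeasure μ₀
  ergodic : Ergodic F₀ μ₀
  gibbsMarkov : IsGibbsMarkov F' m P
  factor_preserving : MeasurePreserving π' μ₀ m
  semiconj : Function.Semiconj π' F₀ F'
  contraction : ∃ C θ : ℝ, 0 < C ∧ θ ∈ Ioo (0 : ℝ) 1 ∧ ∀ x y : X, ∀ n : ℕ, 1 ≤ n →
    dist (F₀^[n] x) (F₀^[n] y) ≤
      C * (θ ^ n + sepPow θ (sepTime F' P (π' x) (π' y)) / θ ^ n)

/-! Young towers -/

/-- The tower `{(x, ℓ) | 0 ≤ ℓ < h x}` of height `h`, as a subset of `X × ℕ`. -/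
def towerSet {X : Type*} (h : X → ℕ) : Set (X × ℕ) := {q | q.2 < h q.1}

/-- The tower map (only its values on `towerSet h` matter). -/
def towerMap {X : Type*} (F₀ : X → X) (h : X → ℕ) (q : X × ℕ) : X × ℕ :=
  if q.2 + 1 < h q.1 then (q.1, q.2 + 1) else (F₀ q.1, 0)

/-- The base `{(x, 0)}` of a tower. -/
def towerBase (X : Type*) : Set (X × ℕ) := {q | q.2 = 0}

/-- The probability measure `(μ₀ × counting) / ∫ h dμ₀` on the tower of height `h`. -/
def towerMeasure {X : Type*} [MeasurableSpace X] (μ₀ : Measure X) (h : X → ℕ) :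
    Measure (X × ℕ) :=
  (∫⁻ x, (h x : ℝ≥0∞) ∂μ₀)⁻¹ • (μ₀.prod Measure.count).restrict (towerSet h)

/-! Two-sided Chernov-Markarian-Zhang structures -/

/-- A two-sided Chernov-Markarian-Zhang structure for `T : M → M` and the probability measure `μ`:
sets `Δ₀ ⊆ M̂ ⊆ M` such that the first return map `T̂` of `M̂` is modelled by the two-sided Young
tower of height `σ` over a two-sided Gibbs-Markov map `F₀ = T̂^σ : Δ₀ → Δ₀`. -/
structure TwoSidedCMZ {M : Type u} [MetricSpace M] [MeasurableSpace M]
    (T : M → M) (μ : Measure M) where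
  /-- the transformation is mixing and measure preserving -/
  mixing : IsMixing T μ
  /-- the set `M̂` -/
  Mhat : Set M
  measurableSet_Mhat : MeasurableSet Mhat
  /-- the base `Δ₀` -/
  base : Set M
  measurableSet_base : MeasurableSet base
  base_subset : base ⊆ Mhat
  base_pos : 0 < μ base
  /-- the first return time of `M̂` is finite -/
  returns : ∀ x ∈ Mhat, ∃ n : ℕ, 1 ≤ n ∧ T^[n] x ∈ Mhat
  /-- the first return time of `M̂` is integrable -/
  return_integrable : IntegrableOn (fun x => (hitTime T Mhat x : ℝ)) Mhat μ
  /-- the return map `F₀` of the base -/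
  F₀ : base → base
  /-- the invariant measure `μ_{Δ₀}` -/
  μ₀ : Measure base
  /-- the base of the one-sided quotient tower -/
  Y : Type v
  instY : MeasurableSpace Y
  /-- the one-sided Gibbs-Markov map -/
  F' : Y → Y
  /-- the invariant measure of the one-sided Gibbs-Markov map -/
  m : Measure Y
  /-- the partition of the one-sided Gibbs-Markov map -/
  P : Set (Set Y)
  /-- the factor map `Δ₀ → Δ₀'` -/
  π' : base → Y
  gibbsMarkov : IsTwoSidedGibbsMarkov F₀ μ₀ F' m P π'
  /-- the return time of the base under `T̂` -/
  σ : base → ℕ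
  σ_pos : ∀ y, 1 ≤ σ y
  σ_integrable : Integrable (fun y => (σ y : ℝ)) μ₀
  σ_const : ∀ A ∈ P, ∀ x y : base, π' x ∈ A → π' y ∈ A → σ x = σ y
  F₀_eq : ∀ y : base, (F₀ y : M) = (firstReturn T Mhat)^[σ y] y
  /-- `(y, ℓ) ↦ T̂^ℓ y` maps the tower measure to the normalised restriction of `μ` to `M̂` -/
  modelled : MeasurePreserving
    (fun q : base × ℕ => (firstReturn T Mhat)^[q.2] (q.1 : M)) (towerMeasure μ₀ σ) (cond μ Mhat)
  /-- the first return time is constant on `T̂^ℓ π'⁻¹ A` for `0 ≤ ℓ < σ(A)` -/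
  return_const : ∀ A ∈ P, ∀ x y : base, π' x ∈ A → π' y ∈ A → ∀ l : ℕ, l < σ x →
    hitTime T Mhat ((firstReturn T Mhat)^[l] (x : M)) =
      hitTime T Mhat ((firstReturn T Mhat)^[l] (y : M))

namespace TwoSidedCMZ

variable {M : Type u} [MetricSpace M] [MeasurableSpace M] {T : M → M} {μ : Measure M}

/-- The first return time `R` of `M̂`. -/
def R (S : TwoSidedCMZ.{u, v} T μ) : M → ℕ := hitTime T S.Mhat

/-- The first return map `T̂`. -/
def That (S : TwoSidedCMZ.{u, v} T μ) : M → M := firstReturn T S.Mhat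

/-- The probability measure `μ_{M̂}`, as a measure on `M`. -/
def μhat (S : TwoSidedCMZ.{u, v} T μ) : Measure M := cond μ S.Mhat

/-- The level set `R_k = {x ∈ M̂ | R x = k + 1}`. -/
def levelSet (S : TwoSidedCMZ.{u, v} T μ) (k : ℕ) : Set M := {x ∈ S.Mhat | S.R x = k + 1}

/-- The projection `(y, ℓ) ↦ T̂^ℓ y` of the tower `Δ̂`. -/
def proj (S : TwoSidedCMZ.{u, v} T μ) (q : S.base × ℕ) : M := S.That^[q.2] (q.1 : M)

/-- The measure `μ_{Δ̂}` of the tower `Δ̂ = Δ₀^σ`. -/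
def μtower (S : TwoSidedCMZ.{u, v} T μ) : Measure (S.base × ℕ) := towerMeasure S.μ₀ S.σ

/-- The height `h = ∑_{ℓ < σ} R ∘ T̂^ℓ` of the big tower `Δ = Δ₀^h`. -/
def h (S : TwoSidedCMZ.{u, v} T μ) (y : S.base) : ℕ :=
  ∑ l ∈ Finset.range (S.σ y), S.R (S.That^[l] (y : M))

/-- The lifted separation time on `Δ₀`. -/
def sep (S : TwoSidedCMZ.{u, v} T μ) (x y : S.base) : ℕ∞ := sepTime S.F' S.P (S.π' x) (S.π' y)

/-- `D_n`: the points of `Δ̂` whose hitting time of the base under the tower map of `Δ̂` is `> n`. -/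
def D (S : TwoSidedCMZ.{u, v} T μ) (n : ℕ) : Set (S.base × ℕ) :=
  {q ∈ towerSet S.σ | n < hitTime (towerMap S.F₀ S.σ) (towerBase S.base) q}

/-- `H_n`: the points of `Δ̂` whose projection to `M̂` has first return time `> n`. -/
def H (S : TwoSidedCMZ.{u, v} T μ) (n : ℕ) : Set (S.base × ℕ) :=
  {q ∈ towerSet S.σ | n < S.R (S.proj q)}

/-- `A_n`: the points of the base whose hitting time of the base under the tower map of
`Δ = Δ₀^h` is `> n`. -/
def A (S : TwoSidedCMZ.{u, v} T μ) (n : ℕ) : Set S.base :=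
  {y | n < hitTime (towerMap S.F₀ S.h) (towerBase S.base) (y, 0)}

/-- The additional assumptions of condition (C1): exponential tails of `Δ̂`, and control of the
distances between consecutive returns to the base. -/
structure C1 (S : TwoSidedCMZ.{u, v} T μ) : Prop where
  exponential_tails : ∃ ρ ∈ Ioo (0 : ℝ) 1,
    (fun n : ℕ => S.μtower.real (S.D n)) =O[atTop] fun n : ℕ => ρ ^ n
  dist_le : ∃ K γ₀ : ℝ, 0 < K ∧ γ₀ ∈ Ioo (0 : ℝ) 1 ∧
    (∀ x y : S.base, ∀ l : ℕ, l < hitTime T S.base (x : M) →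
      dist (T^[l] (x : M)) (T^[l] (y : M)) ≤ K * (dist x y + sepPow γ₀ (S.sep x y))) ∧
    (∀ x y : S.base, 1 ≤ S.sep x y → ∀ l : ℕ, l < hitTime T S.base (x : M) →
      dist (T^[l] (x : M)) (T^[l] (y : M)) ≤ K * (dist x y + dist (S.F₀ x) (S.F₀ y)))

end TwoSidedCMZ

/-! Curves, standard pairs and standard families -/

/-- A curve of finite length `len > 0` without self-intersections in a metric space, parametrised by
arclength on `(0, len)`. End points form a null set and are left out. -/
structure Arc (M : Type u) [MetricSpace M] where
  /-- the length -/
  len : ℝ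
  len_pos : 0 < len
  /-- the arclength parametrisation, of which only the values on `(0, len)` matter -/
  param : ℝ → M
  injOn : InjOn param (Ioo 0 len)
  unit_speed : HasUnitSpeedOn param (Ioo 0 len)

namespace Arc

variable {M : Type u} [MetricSpace M]

/-- The curve as a set of points. -/
def carrier (γ : Arc M) : Set M := γ.param '' Ioo 0 γ.len

/-- The arclength measure `m_γ`, as a measure on `M`. -/
def arclength [MeasurableSpace M] (γ : Arc M) : Measure M :=
  (volume.restrict (Ioo 0 γ.len)).map γ.param

/-- The points of the curve whose distance along the curve from its end points, that is, the length
of the shorter of the two segments cut by the point, is smaller than `ε`. -/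
def nearEnds (γ : Arc M) (ε : ℝ) : Set M :=
  γ.param '' {s ∈ Ioo 0 γ.len | min s (γ.len - s) < ε}

end Arc

section Standard

variable {M : Type u} [MetricSpace M] [MeasurableSpace M]

/-- `(γ, ν)` is a standard pair with respect to the class `U` of standard curves. -/
structure IsStandardPair (U : Set (Arc M)) (γ : Arc M) (ν : Measure M) : Prop where
  mem : γ ∈ U
  prob : IsProbabilityMeasure ν
  absolutelyContinuous : ν ≪ γ.arclength

/-- The `f`-image of the curve `γ` is the countable family `J` of pairwise disjoint curves, up to a
set of arclength zero in `γ` (end points of the pieces, points of discontinuity). -/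
structure IsCurveImage (f : M → M) (γ : Arc M) (J : Set (Arc M)) : Prop where
  countable : J.Countable
  disjoint : J.PairwiseDisjoint Arc.carrier
  subset_image : ∀ γ' ∈ J, γ'.carrier ⊆ f '' γ.carrier
  ae_covers : ∀ᵐ x ∂γ.arclength, ∃ γ' ∈ J, f x ∈ γ'.carrier

/-- A standard family: a measurable family of standard pairs with a probability factor measure on
the index set. -/
structure StandardFamily (U : Set (Arc M)) where
  /-- the index set -/
  I : Type w
  instI : MeasurableSpace I
  /-- the curves of the family -/
  curve : I → Arc M
  /-- the measures on the curves -/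
  meas : Kernel I M
  /-- the factor measure -/
  factor : Measure I
  prob : IsProbabilityMeasure factor
  pair : ∀ i, IsStandardPair U (curve i) (meas i)

/-- The measure `H ↦ ∫ μ_i(H) dλ(i)` induced by a standard family. -/
def StandardFamily.total {U : Set (Arc M)} (G : StandardFamily.{u, w} U) : Measure M :=
  letI := G.instI
  G.factor.bind G.meas

/-- The function `𝒵(G) = sup_{ε > 0} μ(⋃ᵢ {0 < r_i < ε}) / ε`. -/
def StandardFamily.Z {U : Set (Arc M)} (G : StandardFamily.{u, w} U) : ℝ≥0∞ :=
  ⨆ ε : ℝ, ⨆ _ : 0 < ε, G.total (⋃ i, (G.curve i).nearEnds ε) / ENNReal.ofReal ε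

/-- `G'` is the image of the standard family `G` under `f`. Every index `i'` of `G'` has a parent in
`G`; the curves with parent `i` are the pieces `γ_j` of the `f`-image of `γ_i` that have positive
weight `w_j = f_* μ_i (γ_j)`, they carry the measures `w_j⁻¹ f_* μ_i |_{γ_j}`, and the factor
measure of `G'` gives the children of `i` the conditional masses `w_j`. -/
def StandardFamily.IsImage {U : Set (Arc M)} (f : M → M) (G G' : StandardFamily.{u, w} U) :
    Prop :=
  letI := G.instI
  letI := G'.instI
  ∃ (parent : G'.I → G.I) (ω : Kernel G.I G'.I),
    (∀ i, ∃ J ⊆ U, IsCurveImage f (G.curve i) J ∧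
      BijOn G'.curve (parent ⁻¹' {i}) {γ ∈ J | ((G.meas i).map f) γ.carrier ≠ 0}) ∧
    (∀ i', G'.meas i' = cond ((G.meas (parent i')).map f) (G'.curve i').carrier) ∧
    (∀ i, ω i = Measure.sum fun j : ↥(parent ⁻¹' {i}) =>
      ((G.meas i).map f) (G'.curve j).carrier • Measure.dirac (j : G'.I)) ∧
    G'.factor = G.factor.bind ω

end Standard

/-! The conditions (C2)-(C5) -/

namespace TwoSidedCMZ

variable {M : Type u} [MetricSpace M] [MeasurableSpace M] {T : M → M} {μ : Measure M}

/-- (C2): the standard curves lie in `M̂`, the `T̂`-image of a standard curve is a countable family of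
standard curves, and the `T̂`-image of a standard pair is a countable family of standard pairs. -/
def C2 (S : TwoSidedCMZ.{u, v} T μ) (U : Set (Arc M)) : Prop :=
  ∀ γ ∈ U, γ.carrier ⊆ S.Mhat ∧ ∃ J ⊆ U, IsCurveImage S.That γ J ∧
    ∀ ν : Measure M, IsStandardPair U γ ν → ∀ γ' ∈ J, (ν.map S.That) γ'.carrier ≠ 0 →
      IsStandardPair U γ' (cond (ν.map S.That) γ'.carrier)

/-- (C3): whenever `R_k` has positive measure, it is foliated by the pairwise disjoint curves of the
standard family `G k 0`, which represents the normalised restriction of `μ_{M̂}` to `R_k`. -/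
def C3 (S : TwoSidedCMZ.{u, v} T μ) {U : Set (Arc M)} (G : ℕ → ℕ → StandardFamily.{u, w} U) :
    Prop :=
  ∀ k : ℕ, S.μhat (S.levelSet k) ≠ 0 →
    (∀ i, ((G k 0).curve i).carrier ⊆ S.levelSet k) ∧
    (Pairwise fun i j => Disjoint ((G k 0).curve i).carrier ((G k 0).curve j).carrier) ∧
    (G k 0).total = cond S.μhat (S.levelSet k)

/-- (C4): the unstable width of `R_k` is dominated by `k^{-t}`, uniformly over standard curves. -/
def C4 (S : TwoSidedCMZ.{u, v} T μ) (U : Set (Arc M)) (t : ℝ) : Prop :=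
  ∃ C : ℝ, 0 < C ∧ ∃ k₀ : ℕ, ∀ k : ℕ, k₀ < k → ∀ γ ∈ U,
    γ.arclength (γ.carrier ∩ S.levelSet k) ≤ ENNReal.ofReal (C * (k : ℝ) ^ (-t))

/-- `G k (m + 1)` is the `T̂`-image of `G k m` (for the `k` with `μ_{M̂}(R_k) > 0`). -/
def IsImageSequence (S : TwoSidedCMZ.{u, v} T μ) {U : Set (Arc M)}
    (G : ℕ → ℕ → StandardFamily.{u, w} U) : Prop :=
  ∀ k : ℕ, S.μhat (S.levelSet k) ≠ 0 → ∀ m : ℕ, (G k m).IsImage S.That (G k (m + 1))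

/-- (C5): `𝒵(G k m) ≪ k^{t-p}`, uniformly in `m ≥ 1`. -/
def C5 (S : TwoSidedCMZ.{u, v} T μ) {U : Set (Arc M)} (G : ℕ → ℕ → StandardFamily.{u, w} U)
    (t p : ℝ) : Prop :=
  ∃ C : ℝ, 0 < C ∧ ∃ k₀ : ℕ, ∀ k : ℕ, k₀ < k → S.μhat (S.levelSet k) ≠ 0 → ∀ m : ℕ, 1 ≤ m →
    (G k m).Z ≤ ENNReal.ofReal (C * (k : ℝ) ^ (t - p))

/-- The measures of the standard pairs in the families `G k m`, `m ≥ 1`, are uniformly equivalent to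
the normalised arclength measures. -/
def UniformlyEquivalent (S : TwoSidedCMZ.{u, v} T μ) {U : Set (Arc M)}
    (G : ℕ → ℕ → StandardFamily.{u, w} U) : Prop :=
  ∃ C : ℝ, 0 < C ∧ ∀ k : ℕ, S.μhat (S.levelSet k) ≠ 0 → ∀ m : ℕ, 1 ≤ m → ∀ i,
    letI := (G k m).instI
    (G k m).meas i ≤ ENNReal.ofReal (C / ((G k m).curve i).len) • ((G k m).curve i).arclength ∧
    ENNReal.ofReal (1 / (C * ((G k m).curve i).len)) • ((G k m).curve i).arclength ≤
      (G k m).meas i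

end TwoSidedCMZ

end

/-!
A column of the big tower over `y` has height `h y`, the sum of the return times `R` along the
column of `Δ̂` over `y`, and `A_n = {h > n}`. As `μ_{Δ̂}` projects to `μ_{M̂}`, the mean number of
return times `> n` in a column is `∫ σ dμ₀` times `μ_{Δ̂}(H_n) = μ_{M̂}(R > n)`
(`TwoSidedCMZ.tsum_measure_visits`). The theorem says that large values of `h` are produced by a
single large return time, and that large return times in one column do not accumulate.

The key estimate is `TwoSidedCMZ.exists_measure_pairs_le`: there are `κ < 1` and `η > 0` such
that, given `R x > v`, the conditional probability of `R (T̂^m x) > (R x) ^ κ` is `O(v ^ (-η))`,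
uniformly in `m ≥ 1`. Indeed, `T̂^m` maps the normalised measure on `R_k` to the measure induced
by the image family `G k m`. There the curves of length `< 2 ε` carry mass at most
`𝒵 ε ≪ k ^ (t - p) ε` by (C5), and on each longer curve the set `{R > N}` has conditional mass `≪ N ^ (1 - t) / ε`
by (C4). As `p > 1`, a suitable power `ε` of `k` makes both small for `N = k ^ κ` with `κ` close
to `1`. Since `σ` has exponential tails, columns may be truncated at `n ^ s` levels with `s`
small, and the union bound over `m ≤ n ^ s` costs less than the gain `n ^ (-η)`. So, up to
negligible events, every return time in a column that is above a threshold dominates all later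
ones by a power.

For the upper bound, the sum of the return times in such a column is its largest term plus a
contribution of lower order (`sum_le_of_forall_le_rpow`). Hence `h > n` forces a return time
`> n / 4`. The error term involves the tail of `R` at `n ^ (1 - 2 s)`, and a Potter bound compares it
to `r n` (`IsRegularlyVarying.exists_le_mul_rpow`).

For the lower bound, return times in `(n, n ^ L]` that decrease by the power `κ` number at most a
constant `J` (`card_le_of_forall_le_rpow`), and return times above `n ^ L` are negligible against
`n ^ (-a)` by Markov's inequality. Hence the mean number of return times `> n` is at most `J`
times the probability that there is one, up to a small proportion of itself, and one such return
time gives `h > n`.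

The last statement combines the two bounds, since `r n ≫ n ^ (-(|α| + 1))`.
-/

/-! ### Regularly varying functions -/

/-- A measurable function `g` with `g (u + h) - g u → -α h` for all `h` has oscillation over
intervals `[u, u + 1]` bounded uniformly in large `u`. By convergence in measure of
`h ↦ g (u + h) - g u` on `[0, 2]`, both `g u` and `g (u + h)` are close to `g` on most of
`[u + h, u + 2]`, hence to a common value. -/
theorem exists_abs_sub_le_of_tendsto_add_sub {g : ℝ → ℝ} (hg : Measurable g) {α : ℝ}
    (h : ∀ s : ℝ, Tendsto (fun u => g (u + s) - g u) atTop (𝓝 (-α * s))) :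
    ∃ c u₀ : ℝ, ∀ u, u₀ ≤ u → ∀ s ∈ Icc (0 : ℝ) 1, |g (u + s) - g u| ≤ c := by
  set bad : ℝ → Set ℝ := fun u => {s | s ∈ Icc (0 : ℝ) 2 ∧ 1 < |g (u + s) - g u + α * s|} with hbad
  have hbm : ∀ u, MeasurableSet (bad u) := by
    intro u
    have : Measurable fun s => |g (u + s) - g u + α * s| := by fun_prop
    exact measurableSet_Icc.inter (this measurableSet_Ioi)
  have hlim : Tendsto (fun u => volume (bad u)) atTop (𝓝 0) := by
    have h1 : Tendsto (fun u => ∫⁻ s, (bad u).indicator 1 s) atTop (𝓝 (∫⁻ _ : ℝ, (0 : ℝ≥0∞))) := by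
      refine tendsto_lintegral_filter_of_dominated_convergence
        ((Icc (0 : ℝ) 2).indicator (1 : ℝ → ℝ≥0∞)) ?_ ?_ ?_ ?_
      · exact Eventually.of_forall fun u => measurable_one.indicator (hbm u)
      · refine Eventually.of_forall fun u => Eventually.of_forall fun s => ?_
        exact indicator_le_indicator_of_subset (fun s hs => hs.1) (fun _ => zero_le) s
      · rw [lintegral_indicator_one measurableSet_Icc]
        simp
      · refine Eventually.of_forall fun s => ?_
        refine tendsto_const_nhds.congr' ?_
        have h2 : Tendsto (fun u => |g (u + s) - g u + α * s|) atTop (𝓝 0) := by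
          have := ((h s).add_const (α * s)).abs
          simpa using this
        filter_upwards [h2.eventually (gt_mem_nhds one_pos)] with u hu
        rw [indicator_of_notMem]
        exact fun hs => absurd hs.2 (not_lt.2 hu.le)
    simpa [lintegral_indicator_one (hbm _)] using h1
  obtain ⟨u₀, hu₀⟩ := eventually_atTop.1 (hlim.eventually (gt_mem_nhds
    (show (0 : ℝ≥0∞) < ENNReal.ofReal (1 / 4) by simp)))
  refine ⟨2 * (1 + |α| * 2), u₀, fun u hu s hs => ?_⟩
  have hb1 := hu₀ u hu
  have hb2 := hu₀ (u + s) (by linarith [hs.1])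
  -- the points of `[s, 2]` that are bad neither for `u` nor, after translation, for `u + s`
  obtain ⟨x, hx, hx1, hx2⟩ : ∃ x ∈ Icc s 2, x ∉ bad u ∧ x - s ∉ bad (u + s) := by
    by_contra! hcon
    have hsub : Icc s 2 ⊆ bad u ∪ (fun x => x - s) ⁻¹' bad (u + s) := by
      intro x hx
      by_cases hxb : x ∈ bad u
      · exact Or.inl hxb
      · exact Or.inr (hcon x hx hxb)
    have h3 : volume (Icc s 2) ≤ ENNReal.ofReal (1 / 4) + ENNReal.ofReal (1 / 4) := by
      refine (measure_mono hsub).trans ((measure_union_le _ _).trans (add_le_add hb1.le ?_))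
      simp_rw [sub_eq_add_neg]
      rw [measure_preimage_add_right]
      exact hb2.le
    rw [Real.volume_Icc, ← ENNReal.ofReal_add (by norm_num) (by norm_num),
      ENNReal.ofReal_le_ofReal_iff (by norm_num)] at h3
    linarith [hs.2]
  have key : ∀ u' y : ℝ, y ∈ Icc (0 : ℝ) 2 → y ∉ bad u' → |g (u' + y) - g u'| ≤ 1 + |α| * 2 := by
    intro u' y hy hyb
    have h4 : |g (u' + y) - g u' + α * y| ≤ 1 := by
      by_contra! hc
      exact hyb ⟨hy, hc⟩
    have h5 : |α * y| ≤ |α| * 2 := by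
      rw [abs_mul, abs_of_nonneg hy.1]
      exact mul_le_mul_of_nonneg_left hy.2 (abs_nonneg _)
    calc |g (u' + y) - g u'| = |(g (u' + y) - g u' + α * y) - α * y| := by ring_nf
      _ ≤ |g (u' + y) - g u' + α * y| + |α * y| := abs_sub _ _
      _ ≤ _ := add_le_add h4 h5
  have k1 := key u x ⟨hs.1.trans hx.1, hx.2⟩ hx1
  have k2 := key (u + s) (x - s) ⟨by linarith [hx.1], by linarith [hx.2, hs.1]⟩ hx2
  rw [show u + s + (x - s) = u + x by ring] at k2
  rw [abs_le] at k1 k2 ⊢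
  constructor <;> linarith [k1.1, k1.2, k2.1, k2.2]

/-- Potter's lower bound for regularly varying functions, in the form that is needed for their
values at smaller arguments. -/
theorem IsRegularlyVarying.exists_le_mul_rpow {r : ℝ → ℝ} {α : ℝ} (hr : IsRegularlyVarying r α) :
    ∃ C x₀ : ℝ, 0 < C ∧ 1 ≤ x₀ ∧ ∀ x y : ℝ, x₀ ≤ x → x ≤ y →
      r x ≤ C * (y / x) ^ (|α| + 1) * r y := by
  set g : ℝ → ℝ := fun u => Real.log (r (Real.exp u)) with hg
  have hgm : Measurable g := by
    refine Real.measurable_log.comp ?_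
    have : (fun u => r (Real.exp u)) = (Ioi (0 : ℝ)).domRestrict r ∘
        fun u => (⟨Real.exp u, Real.exp_pos u⟩ : Ioi (0 : ℝ)) := rfl
    rw [this]
    exact hr.measurable.comp (Real.measurable_exp.subtype_mk)
  have hlim : ∀ s : ℝ, Tendsto (fun u => g (u + s) - g u) atTop (𝓝 (-α * s)) := by
    intro s
    have h1 := ((hr.tendsto (Real.exp s) (Real.exp_pos s)).comp Real.tendsto_exp_atTop).log
      (by positivity)
    rw [Real.log_rpow (Real.exp_pos s), Real.log_exp] at h1
    refine h1.congr fun u => ?_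
    simp only [Function.comp, hg]
    rw [Real.log_div (hr.pos _ (by positivity)).ne' (hr.pos _ (by positivity)).ne', Real.exp_add,
      mul_comm (Real.exp u)]
  obtain ⟨c, u₀, hc⟩ := exists_abs_sub_le_of_tendsto_add_sub hgm hlim
  obtain ⟨u₁, hu₁⟩ := eventually_atTop.1 ((hlim 1).eventually
    (lt_mem_nhds (show -(|α| + 1) < -α * 1 by linarith [le_abs_self α])))
  set U := max (max u₀ u₁) 0
  have hstep : ∀ (j : ℕ) (u : ℝ), U ≤ u → g u - (|α| + 1) * j ≤ g (u + j) := by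
    intro j
    induction j with
    | zero => intro u _; simp
    | succ j ih =>
      intro u hu
      have h1 := ih u hu
      have h2 := hu₁ (u + j) (by
        have : u₁ ≤ U := (le_max_right _ _).trans (le_max_left _ _)
        have : (0 : ℝ) ≤ j := j.cast_nonneg
        linarith)
      push_cast
      rw [← add_assoc]
      linarith
  have hgrow : ∀ u u' : ℝ, U ≤ u → u ≤ u' → g u ≤ g u' + (|α| + 1) * (u' - u) + c := by
    intro u u' hu huu'
    set j := ⌊u' - u⌋₊
    have hj : (j : ℝ) ≤ u' - u := Nat.floor_le (by linarith)
    have hj' : u' - u < j + 1 := Nat.lt_floor_add_one _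
    have h1 := hstep j u hu
    have h2 := hc (u + j) (by
        have : u₀ ≤ U := (le_max_left _ _).trans (le_max_left _ _)
        have : (0 : ℝ) ≤ j := j.cast_nonneg
        linarith) (u' - u - j) ⟨by linarith, by linarith⟩
    rw [show u + j + (u' - u - j) = u' by ring, abs_le] at h2
    have h3 : (|α| + 1) * (j : ℝ) ≤ (|α| + 1) * (u' - u) :=
      mul_le_mul_of_nonneg_left hj (by positivity)
    linarith [h2.1]
  refine ⟨Real.exp c, Real.exp U, Real.exp_pos _, Real.one_le_exp (le_max_right _ _), ?_⟩
  intro x y hx hxy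
  have hx0 : 0 < x := (Real.exp_pos _).trans_le hx
  have hy0 : 0 < y := hx0.trans_le hxy
  have h1 := hgrow (Real.log x) (Real.log y) ((Real.le_log_iff_exp_le hx0).2 hx)
    (Real.log_le_log hx0 hxy)
  simp only [hg, Real.exp_log hx0, Real.exp_log hy0] at h1
  rw [← Real.log_le_log_iff (hr.pos x hx0)
    (mul_pos (mul_pos (Real.exp_pos _) (Real.rpow_pos_of_pos (by positivity) _)) (hr.pos y hy0)),
    Real.log_mul (mul_pos (Real.exp_pos _) (Real.rpow_pos_of_pos (by positivity) _)).ne'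
      (hr.pos y hy0).ne',
    Real.log_mul (Real.exp_pos _).ne' (Real.rpow_pos_of_pos (by positivity) _).ne',
    Real.log_exp, Real.log_rpow (by positivity), Real.log_div hy0.ne' hx0.ne']
  linarith

/-! ### Curves and standard families -/

section StandardFamilies

variable {M : Type u} [MetricSpace M]

namespace Arc

theorem carrier_subset_nearEnds (γ : Arc M) {ε : ℝ} (h : γ.len < 2 * ε) :
    γ.carrier ⊆ γ.nearEnds ε := by
  rintro x ⟨s, hs, rfl⟩
  refine ⟨s, ⟨hs, ?_⟩, rfl⟩
  rw [min_lt_iff]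
  by_contra! hc
  linarith

variable [MeasurableSpace M]

/-- The arclength measure does not charge a measurable set that misses the curve. -/
theorem arclength_eq_zero_of_disjoint (γ : Arc M) {E : Set M} (hE : MeasurableSet E)
    (h : Disjoint E γ.carrier) : γ.arclength E = 0 := by
  by_cases hp : AEMeasurable γ.param (volume.restrict (Ioo 0 γ.len))
  · rw [arclength, Measure.map_apply_of_aemeasurable hp hE, measure_eq_zero_iff_ae_notMem]
    filter_upwards [ae_restrict_mem measurableSet_Ioo] with s hs hsE
    exact disjoint_left.1 h hsE ⟨s, hs, rfl⟩
  · rw [arclength, Measure.map_of_not_aemeasurable hp]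
    rfl

/-- Restricting to the curve does not change the arclength of a measurable set. The curve itself
need not be measurable, the left side being an outer measure. -/
theorem arclength_le_inter_carrier (γ : Arc M) {E : Set M} (hE : MeasurableSet E) :
    γ.arclength E ≤ γ.arclength (γ.carrier ∩ E) := by
  by_cases hp : AEMeasurable γ.param (volume.restrict (Ioo 0 γ.len))
  · rw [arclength, Measure.map_apply_of_aemeasurable hp hE]
    refine le_trans (measure_mono_ae ?_) (Measure.le_map_apply hp _)
    filter_upwards [ae_restrict_mem measurableSet_Ioo] with s hs hsE
    exact ⟨⟨s, hs, rfl⟩, hsE⟩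
  · rw [arclength, Measure.map_of_not_aemeasurable hp]
    exact zero_le

end Arc

namespace StandardFamily

variable [MeasurableSpace M] {U : Set (Arc M)}

theorem total_apply (G : StandardFamily.{u, w} U) {E : Set M} (hE : MeasurableSet E) :
    letI := G.instI
    G.total E = ∫⁻ i, G.meas i E ∂G.factor := by
  let := G.instI
  exact Measure.bind_apply hE G.meas.aemeasurable

/-- The measure induced by the image of a standard family dominates the push-forward of the induced
measure. -/
theorem total_preimage_le_of_isImage {f : M → M} (hf : Measurable f)
    {G G' : StandardFamily.{u, w} U} (h : G.IsImage f G') {E : Set M} (hE : MeasurableSet E) :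
    G.total (f ⁻¹' E) ≤ G'.total E := by
  let := G.instI
  let := G'.instI
  obtain ⟨parent, ω, hJ, hmeas, hω, hfac⟩ := h
  have hE' : Measurable fun i' => G'.meas i' E := G'.meas.measurable_coe hE
  rw [G.total_apply (hf hE), G'.total_apply hE, hfac,
    Measure.lintegral_bind ω.aemeasurable hE'.aemeasurable]
  refine lintegral_mono fun i => ?_
  obtain ⟨J, -, hIm, hbij⟩ := hJ i
  have := (G.pair i).prob
  set ν := (G.meas i).map f with hν
  have : IsFiniteMeasure ν := by infer_instance
  rw [hω i, lintegral_sum_measure]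
  have hterm : ∀ j : ↥(parent ⁻¹' {i}),
      ∫⁻ i', G'.meas i' E ∂(ν (G'.curve j).carrier • Measure.dirac (j : G'.I)) =
        ν ((G'.curve j).carrier ∩ E) := by
    intro j
    have hpj : parent j = i := j.2
    have hne : ν (G'.curve j).carrier ≠ 0 := (hbij.mapsTo j.2).2
    rw [lintegral_smul_measure, lintegral_dirac' _ hE', hmeas j, hpj, cond_apply' hE, smul_eq_mul,
      ← mul_assoc, ENNReal.mul_inv_cancel hne (measure_ne_top _ _), one_mul]
  refine le_of_le_of_eq ?_ (tsum_congr hterm).symm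
  have : Countable ↥(parent ⁻¹' {i}) := by
    have hc : ({γ ∈ J | ν γ.carrier ≠ 0}).Countable := hIm.countable.mono fun γ hγ => hγ.1
    rw [← hbij.image_eq] at hc
    exact (countable_of_injective_of_countable_image hbij.injOn hc).to_subtype
  have hnull : ν (⋃ γ ∈ {γ ∈ J | ν γ.carrier = 0}, γ.carrier) = 0 :=
    (measure_biUnion_null_iff (hIm.countable.mono fun γ hγ => hγ.1)).2 fun γ hγ => hγ.2
  have hcov : ∀ᵐ x ∂G.meas i, ∃ γ' ∈ J, f x ∈ γ'.carrier :=
    (G.pair i).absolutelyContinuous.ae_le hIm.ae_covers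
  calc G.meas i (f ⁻¹' E)
      ≤ G.meas i (f ⁻¹' ((⋃ j : ↥(parent ⁻¹' {i}), (G'.curve j).carrier ∩ E) ∪
          ⋃ γ ∈ {γ ∈ J | ν γ.carrier = 0}, γ.carrier)) := by
        refine measure_mono_ae ?_
        filter_upwards [hcov] with x hx hxE
        obtain ⟨γ, hγ, hxγ⟩ := hx
        by_cases h0 : ν γ.carrier = 0
        · exact Or.inr (mem_biUnion (show γ ∈ {γ ∈ J | ν γ.carrier = 0} from ⟨hγ, h0⟩) hxγ)
        · obtain ⟨j, hj, rfl⟩ := hbij.surjOn (show γ ∈ {γ ∈ J | ν γ.carrier ≠ 0} from ⟨hγ, h0⟩)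
          exact Or.inl (mem_iUnion.2 ⟨⟨j, hj⟩, hxγ, hxE⟩)
    _ ≤ ν ((⋃ j : ↥(parent ⁻¹' {i}), (G'.curve j).carrier ∩ E) ∪
          ⋃ γ ∈ {γ ∈ J | ν γ.carrier = 0}, γ.carrier) := Measure.le_map_apply hf.aemeasurable _
    _ ≤ ν (⋃ j : ↥(parent ⁻¹' {i}), (G'.curve j).carrier ∩ E) + 0 :=
        (measure_union_le _ _).trans_eq (congrArg _ hnull)
    _ ≤ ∑' j : ↥(parent ⁻¹' {i}), ν ((G'.curve j).carrier ∩ E) := by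
        rw [add_zero]
        exact measure_iUnion_le (μ := ν) _

/-- The mass of a set `E` is at most the mass of the curves shorter than `2 * ε`, which is
controlled by `𝒵`, plus a bound for the mass of `E` on the longer curves. -/
theorem total_le_of_forall_long (G : StandardFamily.{u, w} U) {E : Set M} (hE : MeasurableSet E)
    {ε : ℝ} (hε : 0 < ε) {Q : ℝ≥0∞}
    (hQ : letI := G.instI
      ∀ i, 2 * ε ≤ (G.curve i).len → G.meas i E ≤ Q) :
    G.total E ≤ G.Z * ENNReal.ofReal ε + Q := by
  let := G.instI
  have := G.prob
  set W := toMeasurable G.total (⋃ i, (G.curve i).nearEnds ε)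
  have hW : MeasurableSet W := measurableSet_toMeasurable _ _
  have h1 : G.total W ≤ G.Z * ENNReal.ofReal ε := by
    rw [measure_toMeasurable]
    have : G.total (⋃ i, (G.curve i).nearEnds ε) / ENNReal.ofReal ε ≤ G.Z :=
      le_iSup₂ (f := fun (ε : ℝ) (_ : 0 < ε) =>
        G.total (⋃ i, (G.curve i).nearEnds ε) / ENNReal.ofReal ε) ε hε
    rwa [ENNReal.div_le_iff (by simpa using hε) ENNReal.ofReal_ne_top] at this
  have h2 : G.total (E \ W) ≤ Q := by
    rw [G.total_apply (hE.diff hW)]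
    calc ∫⁻ i, G.meas i (E \ W) ∂G.factor ≤ ∫⁻ _, Q ∂G.factor := by
          refine lintegral_mono fun i => ?_
          by_cases hl : 2 * ε ≤ (G.curve i).len
          · exact (measure_mono sdiff_subset).trans (hQ i hl)
          · have hsub : (G.curve i).carrier ⊆ W :=
              ((G.curve i).carrier_subset_nearEnds (not_le.1 hl)).trans
                ((subset_iUnion (fun i => (G.curve i).nearEnds ε) i).trans
                  (subset_toMeasurable _ _))
            have h0 := (G.curve i).arclength_eq_zero_of_disjoint (hE.diff hW)
              (disjoint_left.2 fun x hx hxc => hx.2 (hsub hxc))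
            rw [(G.pair i).absolutelyContinuous h0]
            exact zero_le
      _ = Q := by simp
  calc G.total E ≤ G.total (W ∪ E \ W) := measure_mono (by
        intro x hx
        by_cases hxW : x ∈ W
        · exact Or.inl hxW
        · exact Or.inr ⟨hx, hxW⟩)
    _ ≤ _ := (measure_union_le _ _).trans (add_le_add h1 h2)

end StandardFamily

end StandardFamilies

/-! ### Towers and return times -/

section HittingTimes

variable {X : Type*}

theorem lt_hitTime_iff {f : X → X} {B : Set X} {x : X} {k : ℕ} :
    k < hitTime f B x ↔ (∃ n, 1 ≤ n ∧ f^[n] x ∈ B) ∧ ∀ n, 1 ≤ n → f^[n] x ∈ B → k < n := by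
  constructor
  · intro h
    have hne : {n : ℕ | 1 ≤ n ∧ f^[n] x ∈ B}.Nonempty := by
      by_contra hc
      rw [not_nonempty_iff_eq_empty] at hc
      simp [hitTime, hc] at h
    exact ⟨hne, fun n hn hB => h.trans_le (Nat.sInf_le ⟨hn, hB⟩)⟩
  · rintro ⟨hne, hall⟩
    have hmem := Nat.sInf_mem (s := {n : ℕ | 1 ≤ n ∧ f^[n] x ∈ B}) hne
    exact hall _ hmem.1 hmem.2

theorem measurable_hitTime [MeasurableSpace X] {f : X → X} (hf : Measurable f) {B : Set X}
    (hB : MeasurableSet B) : Measurable (hitTime f B) := by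
  refine measurable_of_Ioi fun k => ?_
  have hset : hitTime f B ⁻¹' Ioi k = (⋃ n, ⋃ _ : 1 ≤ n, f^[n] ⁻¹' B) ∩
      ⋂ n, ⋂ _ : 1 ≤ n, ⋂ _ : n ≤ k, (f^[n] ⁻¹' B)ᶜ := by
    ext x
    simp only [mem_preimage, mem_Ioi, lt_hitTime_iff, mem_inter_iff, mem_iUnion, mem_iInter,
      mem_compl_iff, exists_prop]
    refine and_congr_right fun _ => forall_congr' fun n => forall_congr' fun _ => ?_
    rw [← not_imp_not, not_lt]
  rw [hset]
  have hn : ∀ n, MeasurableSet (f^[n] ⁻¹' B) := fun n => hf.iterate n hB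
  exact (MeasurableSet.iUnion fun n => MeasurableSet.iUnion fun _ => hn n).inter
    (MeasurableSet.iInter fun n => MeasurableSet.iInter fun _ => MeasurableSet.iInter fun _ =>
      (hn n).compl)

theorem measurable_firstReturn [MeasurableSpace X] {f : X → X} (hf : Measurable f) {B : Set X}
    (hB : MeasurableSet B) : Measurable (firstReturn f B) := by
  have h1 : Measurable fun q : ℕ × X => f^[q.1] q.2 :=
    measurable_from_prod_countable_right fun n => hf.iterate n
  exact h1.comp ((measurable_hitTime hf hB).prodMk measurable_id)

theorem towerMap_iterate {F₀ : X → X} {h : X → ℕ} {x : X} {j : ℕ} (hj : j < h x) :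
    (towerMap F₀ h)^[j] (x, 0) = (x, j) := by
  induction j with
  | zero => rfl
  | succ j ih =>
    rw [Function.iterate_succ_apply', ih (by omega)]
    simp [towerMap, hj]

theorem hitTime_towerMap {F₀ : X → X} {h : X → ℕ} {x : X} (hx : 1 ≤ h x) :
    hitTime (towerMap F₀ h) (towerBase X) (x, 0) = h x := by
  have hmem : 1 ≤ h x ∧ (towerMap F₀ h)^[h x] (x, 0) ∈ towerBase X := by
    refine ⟨hx, ?_⟩
    obtain ⟨j, hj⟩ : ∃ j, h x = j + 1 := ⟨h x - 1, by omega⟩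
    have hstep := towerMap_iterate (F₀ := F₀) (show j < h x by omega)
    rw [hj, Function.iterate_succ_apply', hstep]
    simp [towerMap, hj, towerBase]
  refine le_antisymm (Nat.sInf_le hmem) (le_csInf ⟨_, hmem⟩ fun n hn => ?_)
  by_contra! hlt
  have hbase := hn.2
  rw [towerMap_iterate hlt] at hbase
  have h0 : n = 0 := hbase
  exact absurd hn.1 (by omega)

end HittingTimes

namespace TwoSidedCMZ

variable {M : Type u} [MetricSpace M] [MeasurableSpace M] {T : M → M} {μ : Measure M}

theorem measurable_R (S : TwoSidedCMZ.{u, v} T μ) : Measurable S.R :=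
  measurable_hitTime S.mixing.preserving.measurable S.measurableSet_Mhat

theorem measurable_That (S : TwoSidedCMZ.{u, v} T μ) : Measurable S.That :=
  measurable_firstReturn S.mixing.preserving.measurable S.measurableSet_Mhat

theorem measurable_proj (S : TwoSidedCMZ.{u, v} T μ) : Measurable S.proj :=
  S.modelled.measurable

theorem measurable_proj_level (S : TwoSidedCMZ.{u, v} T μ) (l : ℕ) :
    Measurable fun y => S.proj (y, l) :=
  S.measurable_proj.comp measurable_prodMk_right

theorem measurable_σ (S : TwoSidedCMZ.{u, v} T μ) : Measurable S.σ := by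
  let := S.instY
  refine measurable_to_countable' fun n => ?_
  have hset : S.σ ⁻¹' {n} =
      ⋃ A ∈ {A ∈ S.P | ∃ y, S.π' y ∈ A ∧ S.σ y = n}, S.π' ⁻¹' A := by
    ext x
    simp only [mem_preimage, mem_singleton_iff, mem_iUnion, mem_ofPred_eq, exists_prop]
    constructor
    · intro hx
      obtain ⟨A, ⟨hA, hxA⟩, -⟩ := S.gibbsMarkov.gibbsMarkov.partition.2 (S.π' x)
      exact ⟨A, ⟨hA, x, hxA, hx⟩, hxA⟩
    · rintro ⟨A, ⟨hA, y, hyA, hy⟩, hxA⟩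
      rw [← hy]
      exact S.σ_const A hA x y hxA hyA
  rw [hset]
  exact MeasurableSet.biUnion (S.gibbsMarkov.gibbsMarkov.countable.mono fun A hA => hA.1)
    fun A hA => S.gibbsMarkov.factor_preserving.measurable
      (S.gibbsMarkov.gibbsMarkov.measurableSet A hA.1)

theorem That_mem (S : TwoSidedCMZ.{u, v} T μ) {x : M} (hx : x ∈ S.Mhat) : S.That x ∈ S.Mhat :=
  (Nat.sInf_mem (s := {n : ℕ | 1 ≤ n ∧ T^[n] x ∈ S.Mhat}) (S.returns x hx)).2

theorem one_le_R (S : TwoSidedCMZ.{u, v} T μ) {x : M} (hx : x ∈ S.Mhat) : 1 ≤ S.R x :=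
  (Nat.sInf_mem (s := {n : ℕ | 1 ≤ n ∧ T^[n] x ∈ S.Mhat}) (S.returns x hx)).1

theorem proj_mem (S : TwoSidedCMZ.{u, v} T μ) (q : S.base × ℕ) : S.proj q ∈ S.Mhat := by
  obtain ⟨y, l⟩ := q
  induction l with
  | zero => exact S.base_subset y.2
  | succ l ih =>
    simp only [proj, Function.iterate_succ_apply']
    exact S.That_mem ih

theorem proj_add (S : TwoSidedCMZ.{u, v} T μ) (y : S.base) (l m : ℕ) :
    S.proj (y, l + m) = S.That^[m] (S.proj (y, l)) := by
  simp only [proj]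
  rw [add_comm, Function.iterate_add_apply]

theorem one_le_h (S : TwoSidedCMZ.{u, v} T μ) (y : S.base) : 1 ≤ S.h y := by
  have h0 : S.R (S.That^[0] (y : M)) ≤ S.h y :=
    Finset.single_le_sum (f := fun l => S.R (S.That^[l] (y : M))) (fun _ _ => Nat.zero_le _)
      (Finset.mem_range.2 (S.σ_pos y))
  exact (S.one_le_R (S.proj_mem (y, 0))).trans h0

theorem A_eq (S : TwoSidedCMZ.{u, v} T μ) (n : ℕ) :
    S.A n = {y | n < ∑ l ∈ Finset.range (S.σ y), S.R (S.proj (y, l))} := by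
  ext y
  rw [A, mem_ofPred_eq, hitTime_towerMap (S.one_le_h y)]
  rfl

theorem isProbabilityMeasure_μ₀ (S : TwoSidedCMZ.{u, v} T μ) : IsProbabilityMeasure S.μ₀ :=
  let := S.instY
  S.gibbsMarkov.prob

/-- The mean height `∫ σ dμ₀` of the tower `Δ̂`. -/
noncomputable def meanσ (S : TwoSidedCMZ.{u, v} T μ) : ℝ≥0∞ := ∫⁻ y, (S.σ y : ℝ≥0∞) ∂S.μ₀

theorem meanσ_ne_top (S : TwoSidedCMZ.{u, v} T μ) : S.meanσ ≠ ∞ := by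
  have h := S.σ_integrable.lintegral_lt_top
  simp only [ENNReal.ofReal_natCast] at h
  exact h.ne

theorem one_le_meanσ (S : TwoSidedCMZ.{u, v} T μ) : 1 ≤ S.meanσ := by
  have := S.isProbabilityMeasure_μ₀
  calc (1 : ℝ≥0∞) = ∫⁻ _, 1 ∂S.μ₀ := by simp
    _ ≤ _ := lintegral_mono fun y => Nat.one_le_cast.2 (S.σ_pos y)

theorem meanσ_ne_zero (S : TwoSidedCMZ.{u, v} T μ) : S.meanσ ≠ 0 :=
  (one_pos.trans_le S.one_le_meanσ).ne'

theorem measurableSet_towerSet (S : TwoSidedCMZ.{u, v} T μ) : MeasurableSet (towerSet S.σ) :=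
  measurableSet_lt measurable_snd (S.measurable_σ.comp measurable_fst)

/-- The points of the base whose orbit under `T̂` visits `E` at time `l`, before the column over the
point ends. -/
def visits (S : TwoSidedCMZ.{u, v} T μ) (E : Set M) (l : ℕ) : Set S.base :=
  {y | l < S.σ y ∧ S.proj (y, l) ∈ E}

theorem measurableSet_visits (S : TwoSidedCMZ.{u, v} T μ) {E : Set M} (hE : MeasurableSet E)
    (l : ℕ) : MeasurableSet (S.visits E l) :=
  (measurableSet_lt measurable_const S.measurable_σ).inter (S.measurable_proj_level l hE)

/-- The mean number of visits of a column to `E`, obtained by evaluating the measure of the tower,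
which projects to `μ_{M̂}`, level by level. -/
theorem tsum_measure_visits (S : TwoSidedCMZ.{u, v} T μ) {E : Set M} (hE : MeasurableSet E) :
    ∑' l, S.μ₀ (S.visits E l) = S.meanσ * S.μhat E := by
  have := S.isProbabilityMeasure_μ₀
  have h1 : towerMeasure S.μ₀ S.σ (S.proj ⁻¹' E) = S.μhat E :=
    S.modelled.measure_preimage hE.nullMeasurableSet
  rw [towerMeasure, Measure.smul_apply, Measure.restrict_apply (S.measurable_proj hE),
    Measure.prod_apply_symm ((S.measurable_proj hE).inter S.measurableSet_towerSet),
    lintegral_count, smul_eq_mul] at h1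
  rw [← h1, ← mul_assoc, ← meanσ, ENNReal.mul_inv_cancel S.meanσ_ne_zero S.meanσ_ne_top, one_mul]
  refine tsum_congr fun l => congrArg _ ?_
  ext y
  exact and_comm

theorem μtower_H (S : TwoSidedCMZ.{u, v} T μ) (n : ℕ) :
    S.μtower (S.H n) = S.μhat {x | n < S.R x} := by
  have hE : MeasurableSet {x | n < S.R x} := S.measurable_R measurableSet_Ioi
  rw [show S.μhat {x | n < S.R x} = S.μtower (S.proj ⁻¹' {x | n < S.R x}) from
    (S.modelled.measure_preimage hE.nullMeasurableSet).symm, μtower, towerMeasure,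
    Measure.smul_apply, Measure.smul_apply, Measure.restrict_apply (S.measurable_proj hE),
    Measure.restrict_apply' S.measurableSet_towerSet]
  congr 2
  ext q
  simp only [H, mem_inter_iff, mem_ofPred_eq, mem_preimage]
  tauto

theorem measure_lt_σ_le (S : TwoSidedCMZ.{u, v} T μ) (n : ℕ) :
    S.μ₀ {y | n < S.σ y} ≤ S.meanσ * S.μtower (S.D n) := by
  have := S.isProbabilityMeasure_μ₀
  have hsub : {y | n < S.σ y} ×ˢ {0} ⊆ S.D n ∩ towerSet S.σ := by
    rintro ⟨y, l⟩ ⟨hy, rfl : l = 0⟩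
    have hmem : ((y, 0) : S.base × ℕ) ∈ towerSet S.σ := S.σ_pos y
    refine ⟨⟨hmem, ?_⟩, hmem⟩
    rw [hitTime_towerMap (S.σ_pos y)]
    exact hy
  calc S.μ₀ {y | n < S.σ y} = (S.μ₀.prod Measure.count) ({y | n < S.σ y} ×ˢ {0}) := by
        rw [Measure.prod_prod]; simp
    _ ≤ (S.μ₀.prod Measure.count).restrict (towerSet S.σ) (S.D n) :=
        (measure_mono hsub).trans (Measure.le_restrict_apply _ _)
    _ = S.meanσ * S.μtower (S.D n) := by
        rw [μtower, towerMeasure, Measure.smul_apply, smul_eq_mul, ← mul_assoc, ← meanσ,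
          ENNReal.mul_inv_cancel S.meanσ_ne_zero S.meanσ_ne_top, one_mul]

theorem isProbabilityMeasure_μhat [IsProbabilityMeasure μ] (S : TwoSidedCMZ.{u, v} T μ) :
    IsProbabilityMeasure S.μhat :=
  cond_isProbabilityMeasure (S.base_pos.trans_le (measure_mono S.base_subset)).ne'

theorem isProbabilityMeasure_μtower [IsProbabilityMeasure μ] (S : TwoSidedCMZ.{u, v} T μ) :
    IsProbabilityMeasure S.μtower := by
  have := S.isProbabilityMeasure_μhat
  constructor
  have h : S.μtower (S.proj ⁻¹' univ) = S.μhat univ :=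
    S.modelled.measure_preimage MeasurableSet.univ.nullMeasurableSet
  simpa using h

/-- Exponential tails of `σ`. -/
theorem C1.exists_measure_lt_σ_le [IsProbabilityMeasure μ] {S : TwoSidedCMZ.{u, v} T μ}
    (hC1 : S.C1) : ∃ C ρ : ℝ, 0 < C ∧ ρ ∈ Ioo (0 : ℝ) 1 ∧
      ∀ n : ℕ, S.μ₀.real {y | n < S.σ y} ≤ C * ρ ^ n := by
  have := S.isProbabilityMeasure_μ₀
  have := S.isProbabilityMeasure_μtower
  obtain ⟨ρ, hρ, hO⟩ := hC1.exponential_tails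
  obtain ⟨c, hc⟩ := (Asymptotics.isBigO_nat_atTop_iff fun n hn =>
    absurd hn (pow_pos hρ.1 n).ne').1 hO
  have hpos : 0 < S.meanσ.toReal := ENNReal.toReal_pos S.meanσ_ne_zero S.meanσ_ne_top
  have hb : ∀ n : ℕ, S.μ₀.real {y | n < S.σ y} ≤ S.meanσ.toReal * (max c 1 * ρ ^ n) := by
    intro n
    have h1 := ENNReal.toReal_mono (ENNReal.mul_ne_top S.meanσ_ne_top (measure_ne_top _ _))
      (S.measure_lt_σ_le n)
    rw [ENNReal.toReal_mul] at h1
    refine h1.trans (mul_le_mul_of_nonneg_left ?_ hpos.le)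
    have h2 := hc n
    rw [Real.norm_of_nonneg measureReal_nonneg, Real.norm_of_nonneg (pow_pos hρ.1 n).le] at h2
    exact h2.trans (mul_le_mul_of_nonneg_right (le_max_left _ _) (pow_pos hρ.1 n).le)
  exact ⟨S.meanσ.toReal * max c 1, ρ, by positivity, hρ, fun n => (hb n).trans_eq (by ring)⟩

/-- Markov's inequality for the return time `R`. -/
theorem exists_measure_lt_R_le [IsProbabilityMeasure μ] (S : TwoSidedCMZ.{u, v} T μ) :
    ∃ C : ℝ, 0 < C ∧ ∀ x : ℝ, 0 < x → S.μhat.real {z | x < S.R z} ≤ C / x := by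
  have := S.isProbabilityMeasure_μhat
  have hint : Integrable (fun z => (S.R z : ℝ)) S.μhat :=
    Integrable.smul_measure S.return_integrable (ENNReal.inv_ne_top.2
      (S.base_pos.trans_le (measure_mono S.base_subset)).ne')
  refine ⟨∫ z, (S.R z : ℝ) ∂S.μhat + 1,
    add_pos_of_nonneg_of_pos (integral_nonneg fun _ => Nat.cast_nonneg _) one_pos, fun x hx => ?_⟩
  rw [le_div_iff₀ hx, mul_comm]
  have h1 := mul_meas_ge_le_integral_of_nonneg (Eventually.of_forall fun z =>
    (Nat.cast_nonneg (S.R z) : (0 : ℝ) ≤ S.R z)) hint x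
  have h2 : S.μhat.real {z | x < S.R z} ≤ S.μhat.real {z | x ≤ S.R z} :=
    measureReal_mono fun z hz => (le_of_lt hz : x ≤ S.R z)
  have := mul_le_mul_of_nonneg_left h2 hx.le
  linarith

end TwoSidedCMZ

/-! ### Pairs of large return times -/

namespace TwoSidedCMZ

variable {M : Type u} [MetricSpace M] [MeasurableSpace M] {T : M → M} {μ : Measure M}

theorem measurableSet_lt_R (S : TwoSidedCMZ.{u, v} T μ) (x : ℝ) :
    MeasurableSet {z | x < S.R z} :=
  measurableSet_lt measurable_const (measurable_from_nat.comp S.measurable_R)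

theorem measurableSet_levelSet (S : TwoSidedCMZ.{u, v} T μ) (k : ℕ) :
    MeasurableSet (S.levelSet k) :=
  S.measurableSet_Mhat.inter (S.measurable_R (measurableSet_singleton (k + 1)))

/-- Summing the widths of the sets `R_k` over `k ≥ N - 1`. An arbitrarily small power of `N` is
given away, which reduces the estimate to the convergence of `∑ k ^ (-(1 + s))`. -/
theorem C4.exists_arclength_lt_R_le {S : TwoSidedCMZ.{u, v} T μ} {U : Set (Arc M)} {t s : ℝ}
    (hC4 : S.C4 U t) (hC2 : S.C2 U) (hs : 0 < s) (hst : s ≤ t - 1) :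
    ∃ C N₀ : ℝ, 0 < C ∧ ∀ N : ℝ, N₀ ≤ N → ∀ γ ∈ U,
      γ.arclength {x | N < S.R x} ≤ ENNReal.ofReal (C * N ^ (-(t - 1 - s))) := by
  obtain ⟨C, hC, k₀, hk₀⟩ := hC4
  have hsum : Summable fun k : ℕ => (k : ℝ) ^ (-(1 + s)) := by
    rw [Real.summable_nat_rpow]
    linarith
  have hsum0 : 0 ≤ ∑' k : ℕ, (k : ℝ) ^ (-(1 + s)) := tsum_nonneg fun k => by positivity
  refine ⟨C * 2 ^ (t - 1 - s) * (∑' k : ℕ, (k : ℝ) ^ (-(1 + s)) + 1), k₀ + 2, by positivity, ?_⟩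
  intro N hN γ hγ
  have hk₀0 : (0 : ℝ) ≤ k₀ := k₀.cast_nonneg
  have hN0 : 0 < N := by linarith
  have hsub : γ.carrier ∩ {x | N < S.R x} ⊆
      ⋃ k ∈ {k : ℕ | N < k + 1}, γ.carrier ∩ S.levelSet k := by
    rintro x ⟨hx, hxN⟩
    have hxM := (hC2 γ hγ).1 hx
    have h1 := S.one_le_R hxM
    have hR : S.R x = (S.R x - 1) + 1 := by omega
    refine mem_biUnion (show S.R x - 1 ∈ {k : ℕ | N < k + 1} from ?_) ⟨hx, hxM, hR⟩
    have hxN' : N < S.R x := hxN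
    rw [hR] at hxN'
    exact_mod_cast hxN'
  have hterm : ∀ k : ℕ, N < k + 1 → γ.arclength (γ.carrier ∩ S.levelSet k) ≤
      ENNReal.ofReal (C * 2 ^ (t - 1 - s) * N ^ (-(t - 1 - s)) * (k : ℝ) ^ (-(1 + s))) := by
    intro k hk
    have hkk : k₀ < k := by
      have : (k₀ : ℝ) < k := by linarith
      exact_mod_cast this
    refine (hk₀ k hkk γ hγ).trans (ENNReal.ofReal_le_ofReal ?_)
    have hk0 : (0 : ℝ) < k := by linarith
    have hkN : N / 2 ≤ k := by linarith
    have h1 : (k : ℝ) ^ (-(t - 1 - s)) ≤ (N / 2) ^ (-(t - 1 - s)) :=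
      Real.rpow_le_rpow_of_nonpos (by positivity) hkN (by linarith)
    have h2 : (N / 2) ^ (-(t - 1 - s)) = 2 ^ (t - 1 - s) * N ^ (-(t - 1 - s)) := by
      rw [Real.div_rpow hN0.le (by norm_num), Real.rpow_neg (by norm_num : (0 : ℝ) ≤ 2)]
      field_simp
    calc C * (k : ℝ) ^ (-t) = C * ((k : ℝ) ^ (-(t - 1 - s)) * (k : ℝ) ^ (-(1 + s))) := by
          rw [← Real.rpow_add hk0]; ring_nf
      _ ≤ C * ((N / 2) ^ (-(t - 1 - s)) * (k : ℝ) ^ (-(1 + s))) := by gcongr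
      _ = _ := by rw [h2]; ring
  calc γ.arclength {x | N < S.R x} ≤ γ.arclength (γ.carrier ∩ {x | N < S.R x}) :=
        γ.arclength_le_inter_carrier (S.measurableSet_lt_R N)
    _ ≤ ∑' k : {k : ℕ | N < k + 1}, γ.arclength (γ.carrier ∩ S.levelSet k) :=
        (measure_mono hsub).trans (measure_biUnion_le _ (to_countable _) _)
    _ ≤ ∑' k : {k : ℕ | N < k + 1},
          ENNReal.ofReal (C * 2 ^ (t - 1 - s) * N ^ (-(t - 1 - s)) * (k : ℝ) ^ (-(1 + s))) :=
        ENNReal.tsum_le_tsum fun k => hterm k k.2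
    _ ≤ ∑' k : ℕ,
          ENNReal.ofReal (C * 2 ^ (t - 1 - s) * N ^ (-(t - 1 - s)) * (k : ℝ) ^ (-(1 + s))) :=
        ENNReal.tsum_comp_le_tsum_of_injective Subtype.val_injective
          fun k : ℕ => ENNReal.ofReal
            (C * 2 ^ (t - 1 - s) * N ^ (-(t - 1 - s)) * (k : ℝ) ^ (-(1 + s)))
    _ = ENNReal.ofReal (C * 2 ^ (t - 1 - s) * N ^ (-(t - 1 - s)) *
          ∑' k : ℕ, (k : ℝ) ^ (-(1 + s))) := by
        rw [← tsum_mul_left, ENNReal.ofReal_tsum_of_nonneg (fun k => by positivity)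
          (hsum.mul_left _)]
    _ ≤ _ := by
        refine ENNReal.ofReal_le_ofReal ?_
        have h3 : (0 : ℝ) ≤ C * 2 ^ (t - 1 - s) * N ^ (-(t - 1 - s)) := by positivity
        nlinarith

/-- After a visit to `R_k` the return time is unlikely to reach `(k + 1) ^ κ` at any given later
time, for some `κ < 1`. Curves shorter than `2 * ε` are controlled by (C5), longer ones by (C4),
and `ε` is a power of `k` that makes both contributions small. -/
theorem exists_total_lt_R_le {S : TwoSidedCMZ.{u, v} T μ} {U : Set (Arc M)}
    {G : ℕ → ℕ → StandardFamily.{u, w} U} {t p : ℝ} (hC2 : S.C2 U)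
    (hEquiv : S.UniformlyEquivalent G) (hp : 1 < p) (hpt : p ≤ t) (hC4 : S.C4 U t)
    (hC5 : S.C5 G t p) :
    ∃ κ ∈ Ioo (0 : ℝ) 1, ∃ η C : ℝ, 0 < η ∧ 0 < C ∧ ∃ k₁ : ℕ, ∀ k : ℕ, k₁ < k →
      S.μhat (S.levelSet k) ≠ 0 → ∀ m : ℕ, 1 ≤ m →
      (G k m).total {x | ((k : ℝ) + 1) ^ κ < S.R x} ≤ ENNReal.ofReal (C * (k : ℝ) ^ (-η)) := by
  set q := p - 1 with hq
  have hq0 : 0 < q := by linarith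
  have ht0 : 0 < t - 1 := by linarith
  -- `p - 1` is what the exponents leave to spare for `κ = 1`; a quarter of it goes to each of the
  -- decay rate, the slack in the sum over (C4) and the choice `κ = 1 - δ`
  set δ := q / (4 * (t - 1)) with hδ
  have hδ0 : 0 < δ := by positivity
  have hδt : δ * (t - 1) = q / 4 := by rw [hδ]; field_simp
  have hδ1 : δ ≤ 1 / 4 := by
    rw [hδ, div_le_iff₀ (by positivity)]
    linarith
  obtain ⟨C₄, N₀, hC₄, hN₀⟩ := hC4.exists_arclength_lt_R_le hC2 (s := q / 4) (by positivity)
    (by linarith)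
  obtain ⟨C₃, hC₃, hC₃'⟩ := hEquiv
  obtain ⟨C₅, hC₅, k₀, hk₀⟩ := hC5
  obtain ⟨k₂, hk₂⟩ := eventually_atTop.1
    (((tendsto_rpow_atTop (show 0 < 1 - δ by linarith)).comp
      tendsto_natCast_atTop_atTop).eventually_ge_atTop N₀)
  refine ⟨1 - δ, ⟨by linarith, by linarith⟩, q / 4, C₅ + C₃ * C₄ / 2, by positivity, by positivity,
    max k₀ k₂, fun k hk hk0 m hm => ?_⟩
  let := (G k m).instI
  have hkpos : (0 : ℝ) < k := by exact_mod_cast (Nat.zero_le _).trans_lt hk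
  have hk1 : (1 : ℝ) ≤ k := by exact_mod_cast (Nat.zero_le _).trans_lt hk
  set ε : ℝ := (k : ℝ) ^ (-(t - p) - q / 4) with hε
  have hε0 : 0 < ε := by positivity
  set N : ℝ := ((k : ℝ) + 1) ^ (1 - δ) with hN
  have hkN : (k : ℝ) ^ (1 - δ) ≤ N :=
    Real.rpow_le_rpow hkpos.le (by linarith) (by linarith)
  have hNN : N₀ ≤ N := (hk₂ k ((le_max_right _ _).trans hk.le)).trans hkN
  have hlong : ∀ i, 2 * ε ≤ ((G k m).curve i).len → (G k m).meas i {x | N < S.R x} ≤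
      ENNReal.ofReal (C₃ * C₄ / 2 * (k : ℝ) ^ (-(q / 4))) := by
    intro i hi
    have h1 := (hC₃' k hk0 m hm i).1 {x | N < S.R x}
    rw [Measure.smul_apply, smul_eq_mul] at h1
    refine h1.trans ((mul_le_mul' le_rfl (hN₀ N hNN _ ((G k m).pair i).mem)).trans ?_)
    rw [← ENNReal.ofReal_mul (div_nonneg hC₃.le ((G k m).curve i).len_pos.le)]
    refine ENNReal.ofReal_le_ofReal ?_
    have h2 : N ^ (-(t - 1 - q / 4)) ≤ (k : ℝ) ^ ((1 - δ) * (-(t - 1 - q / 4))) := by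
      rw [Real.rpow_mul hkpos.le]
      exact Real.rpow_le_rpow_of_nonpos (by positivity) hkN (by linarith)
    have h3 : ε⁻¹ * (k : ℝ) ^ ((1 - δ) * (-(t - 1 - q / 4))) ≤ (k : ℝ) ^ (-(q / 4)) := by
      rw [hε, ← Real.rpow_neg hkpos.le, ← Real.rpow_add hkpos]
      refine Real.rpow_le_rpow_of_exponent_le hk1 ?_
      have : 0 ≤ δ * (q / 4) := by positivity
      linarith
    calc C₃ / ((G k m).curve i).len * (C₄ * N ^ (-(t - 1 - q / 4)))
        ≤ C₃ / (2 * ε) * (C₄ * (k : ℝ) ^ ((1 - δ) * (-(t - 1 - q / 4)))) := by gcongr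
      _ = C₃ * C₄ / 2 * (ε⁻¹ * (k : ℝ) ^ ((1 - δ) * (-(t - 1 - q / 4)))) := by
        field_simp
      _ ≤ _ := by gcongr
  refine ((G k m).total_le_of_forall_long (S.measurableSet_lt_R N) hε0 hlong).trans ?_
  have h4 := hk₀ k ((le_max_left _ _).trans_lt hk) hk0 m hm
  calc (G k m).Z * ENNReal.ofReal ε + ENNReal.ofReal (C₃ * C₄ / 2 * (k : ℝ) ^ (-(q / 4)))
      ≤ ENNReal.ofReal (C₅ * (k : ℝ) ^ (t - p)) * ENNReal.ofReal ε +
          ENNReal.ofReal (C₃ * C₄ / 2 * (k : ℝ) ^ (-(q / 4))) := by gcongr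
    _ = ENNReal.ofReal (C₅ * (k : ℝ) ^ (-(q / 4))) +
          ENNReal.ofReal (C₃ * C₄ / 2 * (k : ℝ) ^ (-(q / 4))) := by
        rw [← ENNReal.ofReal_mul (by positivity), mul_assoc, hε, ← Real.rpow_add hkpos]
        congr 4
        ring
    _ = _ := by
        rw [← ENNReal.ofReal_add (by positivity) (by positivity), add_mul]

/-- The points of `M̂` with return time `> v` whose `m`-th image under `T̂` has a return time
that is again large, on a logarithmic scale. -/
def pairs (S : TwoSidedCMZ.{u, v} T μ) (κ v : ℝ) (m : ℕ) : Set M :=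
  {x ∈ S.Mhat | v < S.R x ∧ (S.R x : ℝ) ^ κ < S.R (S.That^[m] x)}

theorem measurableSet_pairs (S : TwoSidedCMZ.{u, v} T μ) (κ v : ℝ) (m : ℕ) :
    MeasurableSet (S.pairs κ v m) := by
  have hκ : Measurable fun x => (S.R x : ℝ) ^ κ :=
    (measurable_from_nat (f := fun n : ℕ => (n : ℝ) ^ κ)).comp S.measurable_R
  have hm : Measurable fun x => (S.R (S.That^[m] x) : ℝ) :=
    measurable_from_nat.comp (S.measurable_R.comp (S.measurable_That.iterate m))
  have h : MeasurableSet {x | (S.R x : ℝ) ^ κ < S.R (S.That^[m] x)} := measurableSet_lt hκ hm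
  exact S.measurableSet_Mhat.inter ((S.measurableSet_lt_R v).inter h)

/-- The correlation of visits to `R_k` with later events is read off from the images of the standard
family that represents `R_k`. -/
theorem measure_levelSet_inter_preimage_le [IsProbabilityMeasure μ] {S : TwoSidedCMZ.{u, v} T μ}
    {U : Set (Arc M)} {G : ℕ → ℕ → StandardFamily.{u, w} U} (hC3 : S.C3 G)
    (hG : S.IsImageSequence G) {k : ℕ} (hk : S.μhat (S.levelSet k) ≠ 0) (m : ℕ) {E : Set M}
    (hE : MeasurableSet E) :
    S.μhat (S.levelSet k ∩ S.That^[m] ⁻¹' E) ≤ S.μhat (S.levelSet k) * (G k m).total E := by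
  have := S.isProbabilityMeasure_μhat
  have hiter : ∀ (m : ℕ) (E : Set M), MeasurableSet E →
      (G k 0).total (S.That^[m] ⁻¹' E) ≤ (G k m).total E := by
    intro m
    induction m with
    | zero => intro E _; exact le_rfl
    | succ m ih =>
      intro E hE
      rw [Function.iterate_succ', preimage_comp]
      exact (ih _ (S.measurable_That hE)).trans
        (StandardFamily.total_preimage_le_of_isImage S.measurable_That (hG k hk m) hE)
  have h1 := hiter m E hE
  rw [(hC3 k hk).2.2, cond_apply (S.measurableSet_levelSet k)] at h1
  calc S.μhat (S.levelSet k ∩ S.That^[m] ⁻¹' E)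
      = S.μhat (S.levelSet k) * ((S.μhat (S.levelSet k))⁻¹ *
          S.μhat (S.levelSet k ∩ S.That^[m] ⁻¹' E)) := by
        rw [← mul_assoc, ENNReal.mul_inv_cancel hk (measure_ne_top _ _), one_mul]
    _ ≤ _ := by gcongr

/-- A large return time is rarely followed, at a given later time, by another one that is large on
a logarithmic scale. -/
theorem exists_measure_pairs_le [IsProbabilityMeasure μ] {S : TwoSidedCMZ.{u, v} T μ}
    {U : Set (Arc M)} {G : ℕ → ℕ → StandardFamily.{u, w} U} {t p : ℝ} (hC2 : S.C2 U)
    (hC3 : S.C3 G) (hG : S.IsImageSequence G)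
    (hEquiv : S.UniformlyEquivalent G) (hp : 1 < p) (hpt : p ≤ t) (hC4 : S.C4 U t)
    (hC5 : S.C5 G t p) :
    ∃ κ ∈ Ioo (0 : ℝ) 1, ∃ η C v₀ : ℝ, 0 < η ∧ 0 < C ∧ ∀ v : ℝ, v₀ ≤ v → ∀ m : ℕ, 1 ≤ m →
      S.μhat.real (S.pairs κ v m) ≤ C * v ^ (-η) * S.μhat.real {x | v < S.R x} := by
  have := S.isProbabilityMeasure_μhat
  obtain ⟨κ, hκ, η, C, hη, hC, k₁, hk₁⟩ := exists_total_lt_R_le hC2 hEquiv hp hpt hC4 hC5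
  refine ⟨κ, hκ, η, C * 2 ^ η, k₁ + 2, hη, by positivity, fun v hv m hm => ?_⟩
  have hk₁0 : (0 : ℝ) ≤ k₁ := k₁.cast_nonneg
  have hv0 : 0 < v := by linarith
  set L : ℕ → Set M := fun k => S.levelSet k ∩ {x | v < S.R x} with hL
  have hLm : ∀ k, MeasurableSet (L k) := fun k =>
    (S.measurableSet_levelSet k).inter (S.measurableSet_lt_R v)
  have hLd : Pairwise (Function.onFun Disjoint L) := by
    intro i j hij
    refine disjoint_left.2 fun x hx hx' => hij ?_
    have h1 : S.R x = i + 1 := hx.1.2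
    have h2 : S.R x = j + 1 := hx'.1.2
    omega
  have hsub : S.pairs κ v m ⊆ ⋃ k, L k ∩ S.That^[m] ⁻¹' {x | ((k : ℝ) + 1) ^ κ < S.R x} := by
    rintro x ⟨hxM, hxv, hxκ⟩
    have h1 := S.one_le_R hxM
    have hR : S.R x = (S.R x - 1) + 1 := by omega
    refine mem_iUnion.2 ⟨S.R x - 1, ⟨⟨hxM, hR⟩, hxv⟩, ?_⟩
    have h2 : ((S.R x - 1 : ℕ) : ℝ) + 1 = S.R x := by exact_mod_cast hR.symm
    rw [mem_preimage, mem_ofPred_eq, h2]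
    exact hxκ
  have hterm : ∀ k, S.μhat (L k ∩ S.That^[m] ⁻¹' {x | ((k : ℝ) + 1) ^ κ < S.R x}) ≤
      ENNReal.ofReal (C * 2 ^ η * v ^ (-η)) * S.μhat (L k) := by
    intro k
    by_cases h0 : S.μhat (L k) = 0
    · exact (measure_mono inter_subset_left).trans (h0.le.trans zero_le)
    obtain ⟨x, hx⟩ := nonempty_of_measure_ne_zero h0
    have hvk : v < k + 1 := by
      have h1 : v < S.R x := hx.2
      rw [hx.1.2] at h1
      exact_mod_cast h1
    have hLk : L k = S.levelSet k := by
      refine inter_eq_left.2 fun z hz => ?_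
      rw [mem_ofPred_eq, hz.2]
      exact_mod_cast hvk
    have hkk : k₁ < k := by
      have : (k₁ : ℝ) < k := by linarith
      exact_mod_cast this
    rw [hLk] at h0 ⊢
    refine (measure_levelSet_inter_preimage_le hC3 hG h0 m (S.measurableSet_lt_R _)).trans ?_
    rw [mul_comm]
    gcongr
    refine (hk₁ k hkk h0 m hm).trans (ENNReal.ofReal_le_ofReal ?_)
    rw [mul_assoc]
    refine mul_le_mul_of_nonneg_left ?_ hC.le
    calc (k : ℝ) ^ (-η) ≤ (v / 2) ^ (-η) :=
          Real.rpow_le_rpow_of_nonpos (by positivity) (by linarith) (by linarith)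
      _ = 2 ^ η * v ^ (-η) := by
          rw [Real.div_rpow hv0.le (by norm_num), Real.rpow_neg (by norm_num : (0 : ℝ) ≤ 2)]
          field_simp
  have hmain : S.μhat (S.pairs κ v m) ≤
      ENNReal.ofReal (C * 2 ^ η * v ^ (-η)) * S.μhat {x | v < S.R x} :=
    calc S.μhat (S.pairs κ v m)
        ≤ ∑' k, S.μhat (L k ∩ S.That^[m] ⁻¹' {x | ((k : ℝ) + 1) ^ κ < S.R x}) :=
          (measure_mono hsub).trans (measure_iUnion_le _)
      _ ≤ ∑' k, ENNReal.ofReal (C * 2 ^ η * v ^ (-η)) * S.μhat (L k) :=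
          ENNReal.tsum_le_tsum hterm
      _ = ENNReal.ofReal (C * 2 ^ η * v ^ (-η)) * S.μhat (⋃ k, L k) := by
          rw [ENNReal.tsum_mul_left, measure_iUnion hLd hLm]
      _ ≤ _ := by
          gcongr
          exact iUnion_subset fun k => inter_subset_right
  have h5 := ENNReal.toReal_mono (ENNReal.mul_ne_top ENNReal.ofReal_ne_top
    (measure_ne_top _ _)) hmain
  rwa [ENNReal.toReal_mul, ENNReal.toReal_ofReal (by positivity)] at h5

end TwoSidedCMZ

/-! ### Long columns and repeated large return times -/

section Sequences

/-- A sum of at most `B` numbers bounded by `X` is at most `X` plus a contribution of lower order,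
if a term above the threshold `v` forces all later terms to be much smaller. -/
theorem sum_le_of_forall_le_rpow {f : ℕ → ℕ} {κ v X : ℝ} {n B : ℕ} (hκ : 0 < κ) (hv : 0 ≤ v)
    (hX : 0 ≤ X) (hB : n ≤ B) (hfX : ∀ l < n, (f l : ℝ) ≤ X)
    (hf : ∀ i j, i < j → j < n → v < f i → (f j : ℝ) ≤ (f i : ℝ) ^ κ) :
    ((∑ l ∈ Finset.range n, f l : ℕ) : ℝ) ≤ X + B * (v + X ^ κ) := by
  have hXκ : 0 ≤ X ^ κ := Real.rpow_nonneg hX κ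
  have hsmall : ∀ s ⊆ Finset.range n, (∀ l ∈ s, (f l : ℝ) ≤ v + X ^ κ) →
      ∑ l ∈ s, (f l : ℝ) ≤ B * (v + X ^ κ) := by
    intro s hs h
    refine (Finset.sum_le_card_nsmul s _ _ h).trans ?_
    rw [nsmul_eq_mul]
    have h1 : s.card ≤ B := ((Finset.card_le_card hs).trans_eq (Finset.card_range n)).trans hB
    gcongr
  push_cast
  classical
  by_cases hex : ∃ i, i < n ∧ v < f i
  · have hspec := Nat.find_spec hex
    have hmin : ∀ l < Nat.find hex, l < n → (f l : ℝ) ≤ v := fun l hl hln =>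
      not_lt.1 fun hc => Nat.find_min hex hl ⟨hln, hc⟩
    set i := Nat.find hex
    rw [← Finset.add_sum_erase _ _ (Finset.mem_range.2 hspec.1)]
    refine add_le_add (hfX i hspec.1) (hsmall _ (Finset.erase_subset _ _) fun l hl => ?_)
    rw [Finset.mem_erase, Finset.mem_range] at hl
    rcases lt_or_gt_of_ne hl.1 with h | h
    · linarith [hmin l h hl.2]
    · have h1 := hf i l h hl.2 hspec.2
      have h2 : (f i : ℝ) ^ κ ≤ X ^ κ :=
        Real.rpow_le_rpow (Nat.cast_nonneg _) (hfX i hspec.1) hκ.le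
      linarith
  · push Not at hex
    have h1 := hsmall _ subset_rfl fun l hl => by
      linarith [hex l (Finset.mem_range.1 hl)]
    linarith

/-- A sequence in `(x, x ^ L]` each of whose terms is at most the `κ`-th power of all earlier ones
has length at most `J` as soon as `L * κ ^ J ≤ 1`. -/
theorem card_le_of_forall_le_rpow {f : ℕ → ℝ} {κ x : ℝ} (hx : 1 ≤ x) (hκ : 0 < κ) (J : ℕ) :
    ∀ (L : ℝ) (s : Finset ℕ), L * κ ^ J ≤ 1 → (∀ l ∈ s, x < f l) → (∀ l ∈ s, f l ≤ x ^ L) →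
      (∀ i ∈ s, ∀ j ∈ s, i < j → f j ≤ f i ^ κ) → s.card ≤ J := by
  induction J with
  | zero =>
    intro L s hL hlow hup _
    rw [pow_zero, mul_one] at hL
    rw [Nat.le_zero, Finset.card_eq_zero, Finset.eq_empty_iff_forall_notMem]
    intro l hl
    have h1 := (hup l hl).trans (Real.rpow_le_rpow_of_exponent_le hx hL)
    rw [Real.rpow_one] at h1
    exact absurd (hlow l hl) (not_lt.2 h1)
  | succ J ih =>
    intro L s hL hlow hup hdec
    rcases s.eq_empty_or_nonempty with rfl | hne
    · simp
    set i := s.min' hne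
    have hi : i ∈ s := s.min'_mem hne
    have h1 := ih (L * κ) (s.erase i) (by rw [mul_assoc, ← pow_succ']; exact hL)
      (fun l hl => hlow l (Finset.mem_of_mem_erase hl))
      (fun l hl => by
        have hls := Finset.mem_of_mem_erase hl
        have hil : i < l := Finset.min'_lt_of_mem_erase_min' s hne hl
        refine (hdec i hi l hls hil).trans ?_
        rw [Real.rpow_mul (by linarith)]
        exact Real.rpow_le_rpow (by linarith [hlow i hi]) (hup i hi) hκ.le)
      (fun a ha b hb => hdec a (Finset.mem_of_mem_erase ha) b (Finset.mem_of_mem_erase hb))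
    rw [Finset.card_erase_of_mem hi] at h1
    omega

/-- If outside `E` at most `J` of the first `B` events happen, then the expected number of events
is at most `J` times the probability of their union, plus the contribution of `E`. -/
theorem sum_measure_le_of_card_le {X : Type*} [MeasurableSpace X] (m : Measure X)
    {V : ℕ → Set X} (hV : ∀ l, MeasurableSet (V l)) (E : Set X) (J B : ℕ)
    (h : ∀ y ∉ E, ∀ s ⊆ Finset.range B, (∀ l ∈ s, y ∈ V l) → s.card ≤ J) :
    ∑ l ∈ Finset.range B, m (V l) ≤ J * m (⋃ l, V l) + B * m E := by
  classical
  have hpt : ∀ y, ∑ l ∈ Finset.range B, (V l).indicator (fun _ => (1 : ℝ≥0∞)) y ≤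
      (⋃ l, V l).indicator (fun _ => (J : ℝ≥0∞)) y + E.indicator (fun _ => (B : ℝ≥0∞)) y := by
    intro y
    have hcard : ∑ l ∈ Finset.range B, (V l).indicator (fun _ => (1 : ℝ≥0∞)) y =
        (((Finset.range B).filter fun l => y ∈ V l).card : ℝ≥0∞) := by
      simp only [indicator_apply]
      rw [Finset.sum_boole]
    rw [hcard]
    by_cases hyE : y ∈ E
    · rw [indicator_of_mem hyE]
      refine le_add_left ?_
      exact_mod_cast (Finset.card_filter_le _ _).trans_eq (Finset.card_range B)
    · by_cases hyV : y ∈ ⋃ l, V l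
      · rw [indicator_of_mem hyV]
        refine le_add_right ?_
        exact_mod_cast h y hyE _ (Finset.filter_subset _ _) fun l hl => (Finset.mem_filter.1 hl).2
      · have h0 : ((Finset.range B).filter fun l => y ∈ V l) = ∅ :=
          Finset.filter_eq_empty_iff.2 fun l _ hl => hyV (mem_iUnion.2 ⟨l, hl⟩)
        rw [h0]
        simp
  calc ∑ l ∈ Finset.range B, m (V l)
      = ∫⁻ y, ∑ l ∈ Finset.range B, (V l).indicator (fun _ => (1 : ℝ≥0∞)) y ∂m := by
        rw [lintegral_finsetSum _ fun l _ => measurable_const.indicator (hV l)]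
        refine Finset.sum_congr rfl fun l _ => ?_
        rw [lintegral_indicator_const (hV l), one_mul]
    _ ≤ ∫⁻ y, (⋃ l, V l).indicator (fun _ => (J : ℝ≥0∞)) y +
          E.indicator (fun _ => (B : ℝ≥0∞)) y ∂m := lintegral_mono hpt
    _ ≤ _ := by
        rw [lintegral_add_left (measurable_const.indicator (MeasurableSet.iUnion hV))]
        exact add_le_add (lintegral_indicator_const_le _ _) (lintegral_indicator_const_le _ _)

theorem isBigO_pow_ceil_rpow {ρ s : ℝ} (hρ : ρ ∈ Ioo (0 : ℝ) 1) (hs : 0 < s) (b : ℝ) :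
    (fun n : ℕ => ρ ^ ⌈(n : ℝ) ^ s⌉₊) =O[atTop] fun n : ℕ => (n : ℝ) ^ b := by
  have hlog : 0 < -Real.log ρ := by linarith [Real.log_neg hρ.1 hρ.2]
  have h1 := ((isLittleO_exp_neg_mul_rpow_atTop hlog (b / s)).isBigO.comp_tendsto
    ((tendsto_rpow_atTop hs).comp tendsto_natCast_atTop_atTop))
  have h2 : (fun n : ℕ => ρ ^ ⌈(n : ℝ) ^ s⌉₊) =O[atTop]
      fun n : ℕ => Real.exp (- -Real.log ρ * (n : ℝ) ^ s) := by
    refine Asymptotics.IsBigO.of_bound 1 (Eventually.of_forall fun n => ?_)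
    rw [Real.norm_of_nonneg (pow_pos hρ.1 _).le, Real.norm_of_nonneg (Real.exp_pos _).le, one_mul,
      neg_neg, ← Real.rpow_def_of_pos hρ.1, ← Real.rpow_natCast]
    exact Real.rpow_le_rpow_of_exponent_ge hρ.1 hρ.2.le (Nat.le_ceil _)
  refine h2.trans (h1.congr (fun n => rfl) fun n => ?_)
  simp only [Function.comp]
  rw [← Real.rpow_mul (Nat.cast_nonneg n), mul_div_cancel₀ _ hs.ne']

theorem isLittleO_natCast_rpow_rpow {b c : ℝ} (h : b < c) :
    (fun n : ℕ => (n : ℝ) ^ b) =o[atTop] fun n : ℕ => (n : ℝ) ^ c := by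
  refine Asymptotics.isLittleO_of_tendsto' ?_ ?_
  · filter_upwards [eventually_ge_atTop 1] with n hn h0
    have hn0 : (0 : ℝ) < n := by exact_mod_cast hn
    exact absurd h0 (by positivity)
  · refine ((tendsto_rpow_neg_atTop (sub_pos.2 h)).comp tendsto_natCast_atTop_atTop).congr' ?_
    filter_upwards [eventually_ge_atTop 1] with n hn
    have hn0 : (0 : ℝ) < n := by exact_mod_cast hn
    simp only [Function.comp]
    rw [← Real.rpow_sub hn0, neg_sub]

theorem ceil_rpow_le_two_mul {s : ℝ} (hs : 0 ≤ s) {n : ℕ} (hn : 1 ≤ n) :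
    (⌈(n : ℝ) ^ s⌉₊ : ℝ) ≤ 2 * (n : ℝ) ^ s := by
  have h1 : (1 : ℝ) ≤ (n : ℝ) ^ s := Real.one_le_rpow (by exact_mod_cast hn) hs
  linarith [Nat.ceil_lt_add_one (show (0 : ℝ) ≤ (n : ℝ) ^ s by linarith)]

end Sequences

namespace TwoSidedCMZ

variable {M : Type u} [MetricSpace M] [MeasurableSpace M] {T : M → M} {μ : Measure M}

/-- The tail `μ_{M̂}(R > x)` of the return time. -/
noncomputable def tail (S : TwoSidedCMZ.{u, v} T μ) (x : ℝ) : ℝ := S.μhat.real {z | x < S.R z}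

theorem tail_nonneg (S : TwoSidedCMZ.{u, v} T μ) (x : ℝ) : 0 ≤ S.tail x := measureReal_nonneg

theorem μtower_real_H (S : TwoSidedCMZ.{u, v} T μ) (n : ℕ) : S.μtower.real (S.H n) = S.tail n := by
  rw [measureReal_def, S.μtower_H, tail, measureReal_def]
  simp only [Nat.cast_lt]

theorem tail_antitone [IsProbabilityMeasure μ] (S : TwoSidedCMZ.{u, v} T μ) : Antitone S.tail := by
  have := S.isProbabilityMeasure_μhat
  exact fun x y hxy => measureReal_mono fun z hz => lt_of_le_of_lt hxy hz

theorem measure_iUnion_visits_le [IsProbabilityMeasure μ] (S : TwoSidedCMZ.{u, v} T μ) {E : Set M}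
    (hE : MeasurableSet E) :
    S.μ₀.real (⋃ l, S.visits E l) ≤ S.meanσ.toReal * S.μhat.real E := by
  have := S.isProbabilityMeasure_μhat
  rw [measureReal_def, measureReal_def, ← ENNReal.toReal_mul]
  exact ENNReal.toReal_mono (ENNReal.mul_ne_top S.meanσ_ne_top (measure_ne_top _ _))
    ((measure_iUnion_le _).trans_eq (S.tsum_measure_visits hE))

/-- The columns of `Δ̂` that contain a return time `> v` followed, after at most `B` steps, by
another one that is large on a logarithmic scale. -/
def pairColumns (S : TwoSidedCMZ.{u, v} T μ) (κ v : ℝ) (B : ℕ) : Set S.base :=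
  ⋃ m ∈ Finset.Icc 1 B, ⋃ l, S.visits (S.pairs κ v m) l

theorem le_rpow_of_notMem_pairColumns {S : TwoSidedCMZ.{u, v} T μ} {κ v : ℝ} {B : ℕ} {y : S.base}
    (hy : y ∉ S.pairColumns κ v B) {i j : ℕ} (hij : i < j) (hjσ : j < S.σ y) (hjB : j ≤ B)
    (hi : v < S.R (S.proj (y, i))) :
    (S.R (S.proj (y, j)) : ℝ) ≤ (S.R (S.proj (y, i)) : ℝ) ^ κ := by
  by_contra! hc
  refine hy (mem_iUnion₂.2 ⟨j - i, Finset.mem_Icc.2 ⟨by omega, by omega⟩,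
    mem_iUnion.2 ⟨i, hij.trans hjσ, S.proj_mem _, hi, ?_⟩⟩)
  rwa [← S.proj_add, Nat.add_sub_cancel' hij.le]

theorem measure_pairColumns_le [IsProbabilityMeasure μ] (S : TwoSidedCMZ.{u, v} T μ) {κ v Q : ℝ}
    (hQ : ∀ m, 1 ≤ m → S.μhat.real (S.pairs κ v m) ≤ Q) (B : ℕ) :
    S.μ₀.real (S.pairColumns κ v B) ≤ B * (S.meanσ.toReal * Q) := by
  have := S.isProbabilityMeasure_μ₀
  calc S.μ₀.real (S.pairColumns κ v B)
      ≤ ∑ m ∈ Finset.Icc 1 B, S.μ₀.real (⋃ l, S.visits (S.pairs κ v m) l) :=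
        measureReal_biUnion_finset_le _ _
    _ ≤ ∑ m ∈ Finset.Icc 1 B, S.meanσ.toReal * Q := by
        refine Finset.sum_le_sum fun m hm => ?_
        exact (S.measure_iUnion_visits_le (S.measurableSet_pairs κ v m)).trans
          (mul_le_mul_of_nonneg_left (hQ m (Finset.mem_Icc.1 hm).1) ENNReal.toReal_nonneg)
    _ = _ := by rw [Finset.sum_const, Nat.card_Icc, Nat.add_sub_cancel, nsmul_eq_mul]

/-- A column of total height `> n` either has many levels, or contains a return time of order `n`,
or contains two large return times. -/
theorem A_subset (S : TwoSidedCMZ.{u, v} T μ) {κ v : ℝ} {n B : ℕ} (hκ : 0 < κ) (hv : 0 ≤ v)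
    (hn : (n : ℝ) / 4 + B * (v + ((n : ℝ) / 4) ^ κ) ≤ n) :
    S.A n ⊆ {y | B < S.σ y} ∪ ((⋃ l, S.visits {x | (n : ℝ) / 4 < S.R x} l) ∪
      S.pairColumns κ v B) := by
  intro y hy
  by_contra hc
  simp only [mem_union, not_or] at hc
  obtain ⟨h1, h2, h3⟩ := hc
  have hσ : S.σ y ≤ B := not_lt.1 h1
  rw [S.A_eq] at hy
  have h4 := sum_le_of_forall_le_rpow (f := fun l => S.R (S.proj (y, l))) hκ hv
    (show (0 : ℝ) ≤ (n : ℝ) / 4 by positivity) hσ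
    (fun l hl => not_lt.1 fun hlt => h2 (mem_iUnion.2 ⟨l, hl, hlt⟩))
    (fun i j hij hj hi => le_rpow_of_notMem_pairColumns h3 hij hj (hj.le.trans hσ) hi)
  have h5 := h4.trans hn
  exact absurd hy (not_lt.2 (by exact_mod_cast h5))

theorem iUnion_visits_subset_A (S : TwoSidedCMZ.{u, v} T μ) (n : ℕ) :
    ⋃ l, S.visits {x | (n : ℝ) < S.R x} l ⊆ S.A n := by
  refine iUnion_subset fun l y hy => ?_
  have h1 : (n : ℝ) < S.R (S.proj (y, l)) := hy.2
  rw [S.A_eq]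
  exact (Nat.cast_lt.1 h1).trans_le
    (Finset.single_le_sum (f := fun l => S.R (S.proj (y, l))) (fun _ _ => Nat.zero_le _)
      (Finset.mem_range.2 hy.1))

/-- The mean number of large return times in a column, bounded by truncating the column at height
`B` and applying `card_le_of_forall_le_rpow` off the columns with huge or with two large return
times. -/
theorem meanσ_mul_tail_le [IsProbabilityMeasure μ] (S : TwoSidedCMZ.{u, v} T μ)
    {C ρ : ℝ} (hρ : ρ ∈ Ioo (0 : ℝ) 1) (hC : 0 ≤ C)
    (hσ : ∀ n : ℕ, S.μ₀.real {y | n < S.σ y} ≤ C * ρ ^ n) {κ L : ℝ} (hκ : 0 < κ) {J : ℕ}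
    (hJ : L * κ ^ J ≤ 1) {n : ℕ} (hn : 1 ≤ n) (B : ℕ) {Q : ℝ}
    (hQ : ∀ m, 1 ≤ m → S.μhat.real (S.pairs κ n m) ≤ Q) :
    S.meanσ.toReal * S.tail n ≤ J * S.μ₀.real (S.A n) +
      (B * (S.meanσ.toReal * S.tail ((n : ℝ) ^ L) + B * (S.meanσ.toReal * Q)) +
        C * (1 - ρ)⁻¹ * ρ ^ B) := by
  have := S.isProbabilityMeasure_μ₀
  have := S.isProbabilityMeasure_μhat
  have hQ0 : 0 ≤ Q := measureReal_nonneg.trans (hQ 1 le_rfl)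
  set V := S.visits {x | (n : ℝ) < S.R x} with hV
  set E := (⋃ l, S.visits {x | (n : ℝ) ^ L < S.R x} l) ∪ S.pairColumns κ n B with hE
  have hEm : S.μ₀.real E ≤ S.meanσ.toReal * S.tail ((n : ℝ) ^ L) + B * (S.meanσ.toReal * Q) :=
    (measureReal_union_le _ _).trans (add_le_add
      (S.measure_iUnion_visits_le (S.measurableSet_lt_R _)) (S.measure_pairColumns_le hQ B))
  have h1 : ∑ l ∈ Finset.range B, S.μ₀ (V l) ≤ J * S.μ₀ (⋃ l, V l) + B * S.μ₀ E := by
    refine sum_measure_le_of_card_le S.μ₀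
      (fun l => S.measurableSet_visits (S.measurableSet_lt_R _) l) E J B fun y hy s hs hsV => ?_
    simp only [hE, mem_union, not_or] at hy
    refine card_le_of_forall_le_rpow (f := fun l => (S.R (S.proj (y, l)) : ℝ))
      (show (1 : ℝ) ≤ n by exact_mod_cast hn) hκ J L s hJ (fun l hl => (hsV l hl).2)
      (fun l hl => not_lt.1 fun hlt => hy.1 (mem_iUnion.2 ⟨l, (hsV l hl).1, hlt⟩))
      (fun i hi j hj hij => le_rpow_of_notMem_pairColumns hy.2 hij (hsV j hj).1
        (Finset.mem_range.1 (hs hj)).le (hsV i hi).2)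
  have h2 : ∑' l, S.μ₀ (V (l + B)) ≤ ENNReal.ofReal (C * (1 - ρ)⁻¹ * ρ ^ B) := by
    calc ∑' l, S.μ₀ (V (l + B)) ≤ ∑' l : ℕ, ENNReal.ofReal (C * ρ ^ B * ρ ^ l) := by
          refine ENNReal.tsum_le_tsum fun l => ?_
          rw [← ENNReal.ofReal_toReal (measure_ne_top S.μ₀ (V (l + B)))]
          refine ENNReal.ofReal_le_ofReal ?_
          calc S.μ₀.real (V (l + B)) ≤ S.μ₀.real {y | l + B < S.σ y} :=
                measureReal_mono fun y hy => hy.1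
            _ ≤ C * ρ ^ (l + B) := hσ _
            _ = C * ρ ^ B * ρ ^ l := by rw [pow_add]; ring
      _ = ENNReal.ofReal (C * (1 - ρ)⁻¹ * ρ ^ B) := by
          rw [← ENNReal.ofReal_tsum_of_nonneg
            (fun l => mul_nonneg (mul_nonneg hC (pow_pos hρ.1 _).le) (pow_pos hρ.1 _).le)
            ((summable_geometric_of_lt_one hρ.1.le hρ.2).mul_left _), tsum_mul_left,
            tsum_geometric_of_lt_one hρ.1.le hρ.2]
          congr 1
          ring
  have h3 : S.meanσ * S.μhat {x | (n : ℝ) < S.R x} ≤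
      (J * S.μ₀ (⋃ l, V l) + B * S.μ₀ E) + ENNReal.ofReal (C * (1 - ρ)⁻¹ * ρ ^ B) := by
    rw [← S.tsum_measure_visits (S.measurableSet_lt_R _),
      ← ENNReal.summable.sum_add_tsum_nat_add' (k := B)]
    exact add_le_add h1 h2
  have hnn : 0 ≤ C * (1 - ρ)⁻¹ * ρ ^ B :=
    mul_nonneg (mul_nonneg hC (inv_nonneg.2 (by linarith [hρ.2]))) (pow_pos hρ.1 _).le
  have hfin1 : (J : ℝ≥0∞) * S.μ₀ (⋃ l, V l) ≠ ∞ :=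
    ENNReal.mul_ne_top (ENNReal.natCast_ne_top _) (measure_ne_top _ _)
  have hfin2 : (B : ℝ≥0∞) * S.μ₀ E ≠ ∞ :=
    ENNReal.mul_ne_top (ENNReal.natCast_ne_top _) (measure_ne_top _ _)
  have h4 := ENNReal.toReal_mono (ENNReal.add_ne_top.2
    ⟨ENNReal.add_ne_top.2 ⟨hfin1, hfin2⟩, ENNReal.ofReal_ne_top⟩) h3
  rw [ENNReal.toReal_mul, ENNReal.toReal_add (ENNReal.add_ne_top.2 ⟨hfin1, hfin2⟩)
    ENNReal.ofReal_ne_top, ENNReal.toReal_add hfin1 hfin2, ENNReal.toReal_mul, ENNReal.toReal_mul,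
    ENNReal.toReal_natCast, ENNReal.toReal_natCast, ENNReal.toReal_ofReal hnn] at h4
  have h5 : S.μ₀.real (⋃ l, V l) ≤ S.μ₀.real (S.A n) :=
    measureReal_mono (S.iUnion_visits_subset_A n)
  have h6 : (J : ℝ) * S.μ₀.real (⋃ l, V l) ≤ J * S.μ₀.real (S.A n) := by gcongr
  have h7 : (B : ℝ) * S.μ₀.real E ≤
      B * (S.meanσ.toReal * S.tail ((n : ℝ) ^ L) + B * (S.meanσ.toReal * Q)) := by gcongr
  simp only [measureReal_def] at h6 h7
  rw [tail, measureReal_def, measureReal_def]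
  linarith

end TwoSidedCMZ

/-! ### The two bounds -/

section RegularVariation

theorem IsRegularlyVarying.rpow_isBigO {r : ℝ → ℝ} {α : ℝ} (hr : IsRegularlyVarying r α) :
    (fun n : ℕ => (n : ℝ) ^ (-(|α| + 1))) =O[atTop] fun n : ℕ => r n := by
  obtain ⟨C, x₀, hC, hx₀, h⟩ := hr.exists_le_mul_rpow
  have hx0 : 0 < x₀ := by linarith
  have hr0 : 0 < r x₀ := hr.pos _ hx0
  refine Asymptotics.IsBigO.of_bound (C * x₀ ^ (-(|α| + 1)) / r x₀) ?_
  filter_upwards [tendsto_natCast_atTop_atTop.eventually_ge_atTop x₀] with n hn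
  have hn0 : (0 : ℝ) < n := hx0.trans_le hn
  have h1 := h x₀ n le_rfl hn
  rw [Real.norm_of_nonneg (by positivity), Real.norm_of_nonneg (hr.pos _ hn0).le,
    div_mul_eq_mul_div, le_div_iff₀ hr0]
  rw [Real.div_rpow hn0.le hx0.le] at h1
  calc (n : ℝ) ^ (-(|α| + 1)) * r x₀
      ≤ (n : ℝ) ^ (-(|α| + 1)) * (C * ((n : ℝ) ^ (|α| + 1) / x₀ ^ (|α| + 1)) * r n) := by gcongr
    _ = C * x₀ ^ (-(|α| + 1)) * r n := by
      rw [Real.rpow_neg hn0.le, Real.rpow_neg hx0.le]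
      field_simp

/-- An antitone function dominated by `r` along the integers inherits Potter's bound. -/
theorem IsRegularlyVarying.exists_antitone_le {r : ℝ → ℝ} {α : ℝ} (hr : IsRegularlyVarying r α)
    {f : ℝ → ℝ} (hf : Antitone f) (hO : (fun n : ℕ => f n) =O[atTop] fun n : ℕ => r n) :
    ∃ C x₀ : ℝ, 0 < C ∧ 0 < x₀ ∧ ∀ x y : ℝ, x₀ ≤ x → x ≤ y →
      f x ≤ C * (y / x) ^ (|α| + 1) * r y := by
  obtain ⟨C, x₁, hC, hx₁, h⟩ := hr.exists_le_mul_rpow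
  obtain ⟨c, hc0, hc⟩ := hO.exists_pos
  obtain ⟨N, hN⟩ := eventually_atTop.1 hc.bound
  refine ⟨c * C * 2 ^ (|α| + 1), max x₁ N + 1, by positivity, by positivity, fun x y hx hxy => ?_⟩
  have hx1 : x₁ + 1 ≤ x := (by gcongr; exact le_max_left _ _ : x₁ + 1 ≤ max x₁ N + 1).trans hx
  have hxN : (N : ℝ) + 1 ≤ x := (by gcongr; exact le_max_right _ _ : (N : ℝ) + 1 ≤ _).trans hx
  have hx0 : 0 < x := by linarith
  set n := ⌊x⌋₊
  have hnx : (n : ℝ) ≤ x := Nat.floor_le hx0.le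
  have hxn : x < n + 1 := Nat.lt_floor_add_one x
  have hn1 : x₁ ≤ n := by linarith
  have hn0 : (0 : ℝ) < n := by linarith
  have hNn : N ≤ n := by
    have : (N : ℝ) ≤ n := by linarith
    exact_mod_cast this
  have hry : 0 < r y := hr.pos _ (hx0.trans_le hxy)
  have h1 := hN n hNn
  rw [Real.norm_of_nonneg (hr.pos _ hn0).le] at h1
  have h2 : y / n ≤ 2 * (y / x) := by
    rw [mul_div_assoc', div_le_div_iff₀ hn0 hx0]
    nlinarith
  calc f x ≤ f n := hf hnx
    _ ≤ c * r n := (Real.le_norm_self _).trans h1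
    _ ≤ c * (C * (y / n) ^ (|α| + 1) * r y) := by
      gcongr
      exact h _ _ hn1 (hnx.trans hxy)
    _ ≤ c * (C * (2 * (y / x)) ^ (|α| + 1) * r y) := by
      have : 0 ≤ y / n := div_nonneg (hx0.le.trans hxy) hn0.le
      gcongr
    _ = _ := by
      rw [Real.mul_rpow (by norm_num) (div_nonneg (hx0.le.trans hxy) hx0.le)]
      ring

end RegularVariation

namespace TwoSidedCMZ

variable {M : Type u} [MetricSpace M] [MeasurableSpace M] {T : M → M} {μ : Measure M}

/-- The upper bound: up to negligible events, a column is higher than `n` only if a single return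
time in it exceeds `n / 4`. The columns are cut at height `n ^ s` and the threshold for large return
times is `n ^ (1 - 2 * s)`, with `s` so small that the loss in passing from `r n` to
`r (n ^ (1 - 2 * s))` is beaten by the gain in the estimate for pairs. -/
theorem isBigO_measure_A [IsProbabilityMeasure μ] {S : TwoSidedCMZ.{u, v} T μ} (hC1 : S.C1)
    {κ η C v₀ : ℝ} (hκ : κ ∈ Ioo (0 : ℝ) 1) (hη : 0 < η) (hC : 0 < C)
    (hpairs : ∀ v : ℝ, v₀ ≤ v → ∀ m : ℕ, 1 ≤ m →
      S.μhat.real (S.pairs κ v m) ≤ C * v ^ (-η) * S.tail v)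
    {r : ℝ → ℝ} {α : ℝ} (hr : IsRegularlyVarying r α)
    (hO : (fun n : ℕ => S.tail n) =O[atTop] fun n : ℕ => r n) :
    (fun n : ℕ => S.μ₀.real (S.A n)) =O[atTop] fun n : ℕ => r n := by
  have := S.isProbabilityMeasure_μ₀
  obtain ⟨Cσ, ρ, hCσ, hρ, hσ⟩ := hC1.exists_measure_lt_σ_le
  obtain ⟨Cr, x₀, hCr, hx₀, htail⟩ := hr.exists_antitone_le S.tail_antitone hO
  set β := |α| + 1 with hβ
  have hβ0 : 0 < β := by positivity
  obtain ⟨s, hs0, hs4, hsκ, hsη⟩ : ∃ s : ℝ, 0 < s ∧ s ≤ 1 / 4 ∧ s ≤ (1 - κ) / 2 ∧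
      s ≤ η / (2 * (1 + 2 * β)) := by
    refine ⟨min (min (1 / 4) ((1 - κ) / 2)) (η / (2 * (1 + 2 * β))), ?_,
      (min_le_left _ _).trans (min_le_left _ _), (min_le_left _ _).trans (min_le_right _ _),
      min_le_right _ _⟩
    have : 0 < 1 - κ := by linarith [hκ.2]
    positivity
  rw [le_div_iff₀ (by positivity)] at hsη
  have hsη' : s * η ≤ 1 / 4 * η := by gcongr
  set B : ℕ → ℕ := fun n => ⌈(n : ℝ) ^ s⌉₊ with hB
  have hbound : ∀ᶠ n : ℕ in atTop, S.μ₀.real (S.A n) ≤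
      Cσ * ρ ^ B n + (S.meanσ.toReal * Cr * 4 ^ β + 2 * S.meanσ.toReal * C * Cr) * r n := by
    have e1 := ((tendsto_rpow_atTop hs0).comp
      tendsto_natCast_atTop_atTop).eventually_ge_atTop (16 / 3 : ℝ)
    have e2 := ((tendsto_rpow_atTop (show 0 < 1 - 2 * s by linarith)).comp
      tendsto_natCast_atTop_atTop).eventually_ge_atTop (max x₀ v₀)
    have e3 := (tendsto_natCast_atTop_atTop (R := ℝ)).eventually_ge_atTop (4 * x₀)
    filter_upwards [e1, e2, e3, eventually_ge_atTop 1] with n h1 h2 h3 hn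
    simp only [Function.comp] at h1 h2
    have hn1 : (1 : ℝ) ≤ n := by exact_mod_cast hn
    have hn0 : (0 : ℝ) < n := by linarith
    have hBn : (B n : ℝ) ≤ 2 * (n : ℝ) ^ s := ceil_rpow_le_two_mul hs0.le hn
    set v : ℝ := (n : ℝ) ^ (1 - 2 * s) with hv
    have hv0 : 0 < v := by positivity
    have hrn : 0 < r n := hr.pos _ hn0
    have hκv : ((n : ℝ) / 4) ^ κ ≤ v := by
      calc ((n : ℝ) / 4) ^ κ ≤ (n : ℝ) ^ κ :=
            Real.rpow_le_rpow (by positivity) (by linarith) hκ.1.le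
        _ ≤ v := Real.rpow_le_rpow_of_exponent_le hn1 (by linarith)
    have hsplit : (n : ℝ) / 4 + B n * (v + ((n : ℝ) / 4) ^ κ) ≤ n := by
      have e4 : (n : ℝ) ^ s * (n : ℝ) ^ s * v = n := by
        rw [hv, ← Real.rpow_add hn0, ← Real.rpow_add hn0]
        ring_nf
        exact Real.rpow_one _
      have e5 : (B n : ℝ) * (v + ((n : ℝ) / 4) ^ κ) ≤ 2 * (n : ℝ) ^ s * (v + v) := by gcongr
      have e6 : 16 / 3 * ((n : ℝ) ^ s * v) ≤ (n : ℝ) ^ s * ((n : ℝ) ^ s * v) := by gcongr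
      nlinarith
    have hA := S.A_subset hκ.1 hv0.le hsplit
    have t1 := S.measure_iUnion_visits_le (S.measurableSet_lt_R ((n : ℝ) / 4))
    have t2 : S.μhat.real {x | (n : ℝ) / 4 < S.R x} ≤ Cr * 4 ^ β * r n := by
      have := htail (n / 4) n (by linarith) (by linarith)
      rwa [show (n : ℝ) / (n / 4) = 4 by field_simp] at this
    have t3 := S.measure_pairColumns_le (hpairs v ((le_max_right _ _).trans h2)) (B n)
    have hvn : v ≤ n := by
      calc v ≤ (n : ℝ) ^ (1 : ℝ) := Real.rpow_le_rpow_of_exponent_le hn1 (by linarith)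
        _ = n := Real.rpow_one _
    have t4 : (B n : ℝ) * (v ^ (-η) * S.tail v) ≤ 2 * Cr * r n := by
      have e7 : (n : ℝ) ^ s * (v ^ (-η) * ((n : ℝ) / v) ^ β) ≤ 1 := by
        have : (n : ℝ) / v = (n : ℝ) ^ (2 * s) := by
          rw [div_eq_iff hv0.ne', hv, ← Real.rpow_add hn0]
          ring_nf
          exact (Real.rpow_one _).symm
        rw [this, hv, ← Real.rpow_mul hn0.le, ← Real.rpow_mul hn0.le, ← Real.rpow_add hn0,
          ← Real.rpow_add hn0]
        refine Real.rpow_le_one_of_one_le_of_nonpos hn1 ?_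
        nlinarith
      calc (B n : ℝ) * (v ^ (-η) * S.tail v)
          ≤ 2 * (n : ℝ) ^ s * (v ^ (-η) * (Cr * ((n : ℝ) / v) ^ β * r n)) := by
            gcongr
            · exact mul_nonneg (by positivity) (S.tail_nonneg v)
            · exact htail v n ((le_max_left _ _).trans h2) hvn
        _ = 2 * Cr * r n * ((n : ℝ) ^ s * (v ^ (-η) * ((n : ℝ) / v) ^ β)) := by ring
        _ ≤ 2 * Cr * r n * 1 := by gcongr
        _ = _ := mul_one _
    have t5 : (B n : ℝ) * (S.meanσ.toReal * (C * v ^ (-η) * S.tail v)) ≤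
        S.meanσ.toReal * C * (2 * Cr * r n) := by
      calc (B n : ℝ) * (S.meanσ.toReal * (C * v ^ (-η) * S.tail v))
          = S.meanσ.toReal * C * ((B n : ℝ) * (v ^ (-η) * S.tail v)) := by ring
        _ ≤ _ := by gcongr
    have t6 : S.meanσ.toReal * S.μhat.real {x | (n : ℝ) / 4 < S.R x} ≤
        S.meanσ.toReal * (Cr * 4 ^ β * r n) := by gcongr
    calc S.μ₀.real (S.A n) ≤ _ := measureReal_mono hA
      _ ≤ S.μ₀.real {y | B n < S.σ y} + _ := measureReal_union_le _ _
      _ ≤ S.μ₀.real {y | B n < S.σ y} +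
          (S.μ₀.real (⋃ l, S.visits {x | (n : ℝ) / 4 < S.R x} l) +
            S.μ₀.real (S.pairColumns κ v (B n))) := by
          gcongr
          exact measureReal_union_le _ _
      _ ≤ _ := by linarith [hσ (B n)]
  have hfinal : (fun n : ℕ => Cσ * ρ ^ B n +
      (S.meanσ.toReal * Cr * 4 ^ β + 2 * S.meanσ.toReal * C * Cr) * r n) =O[atTop]
      fun n : ℕ => r n :=
    (((isBigO_pow_ceil_rpow hρ hs0 (-β)).trans hr.rpow_isBigO).const_mul_left Cσ).add
      ((Asymptotics.isBigO_refl _ _).const_mul_left _)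
  refine Asymptotics.IsBigO.trans (Asymptotics.IsBigO.of_bound 1 ?_) hfinal
  filter_upwards [hbound] with n hn
  rw [Real.norm_of_nonneg measureReal_nonneg, one_mul]
  exact hn.trans (Real.le_norm_self _)

/-- The lower bound: off negligible events, the number of return times `> n` in a column is at most
a constant `J`, so that the mean number of such return times is comparable with the probability that
there is one. Return times beyond `n ^ L` are negligible against `n ^ (-a)` by Markov's
inequality. -/
theorem tail_isBigO [IsProbabilityMeasure μ] {S : TwoSidedCMZ.{u, v} T μ} (hC1 : S.C1)
    {κ η C v₀ : ℝ} (hκ : κ ∈ Ioo (0 : ℝ) 1) (hη : 0 < η)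
    (hpairs : ∀ v : ℝ, v₀ ≤ v → ∀ m : ℕ, 1 ≤ m →
      S.μhat.real (S.pairs κ v m) ≤ C * v ^ (-η) * S.tail v)
    {a : ℝ} (ha : 0 < a)
    (hO : (fun n : ℕ => (n : ℝ) ^ (-a)) =O[atTop] fun n : ℕ => S.tail n) :
    (fun n : ℕ => S.tail n) =O[atTop] fun n : ℕ => S.μ₀.real (S.A n) := by
  have := S.isProbabilityMeasure_μ₀
  obtain ⟨Cσ, ρ, hCσ, hρ, hσ⟩ := hC1.exists_measure_lt_σ_le
  obtain ⟨CR, hCR, hR⟩ := S.exists_measure_lt_R_le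
  -- the truncation height enters squared and is to be beaten by `n ^ (-η)`
  set s := η / 4 with hs
  have hs0 : 0 < s := by positivity
  set L := a + 1 + s with hL
  have hL0 : 0 < L := by positivity
  obtain ⟨J, hJ⟩ := exists_pow_lt_of_lt_one (show 0 < L⁻¹ by positivity) hκ.2
  have hJ' : L * κ ^ J ≤ 1 := by
    calc L * κ ^ J ≤ L * L⁻¹ := by gcongr
      _ = 1 := mul_inv_cancel₀ hL0.ne'
  set B : ℕ → ℕ := fun n => ⌈(n : ℝ) ^ s⌉₊ with hB
  have hmean : 0 < S.meanσ.toReal := ENNReal.toReal_pos S.meanσ_ne_zero S.meanσ_ne_top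
  have hpow : ∀ b c : ℝ, b < c → (fun n : ℕ => (n : ℝ) ^ b) =o[atTop] fun n : ℕ => (n : ℝ) ^ c :=
    fun b c hbc => isLittleO_natCast_rpow_rpow hbc
  have hBO : (fun n : ℕ => (B n : ℝ)) =O[atTop] fun n : ℕ => (n : ℝ) ^ s := by
    refine Asymptotics.IsBigO.of_bound 2 ?_
    filter_upwards [eventually_ge_atTop 1] with n hn
    rw [Real.norm_of_nonneg (Nat.cast_nonneg _), Real.norm_of_nonneg (by positivity)]
    exact ceil_rpow_le_two_mul hs0.le hn
  have hmulpow : ∀ b c : ℝ, (fun n : ℕ => (n : ℝ) ^ b * (n : ℝ) ^ c) =ᶠ[atTop]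
      fun n : ℕ => (n : ℝ) ^ (b + c) := by
    intro b c
    filter_upwards [eventually_ge_atTop 1] with n hn
    have hn0 : (0 : ℝ) < n := by exact_mod_cast hn
    rw [Real.rpow_add hn0]
  have o1 : (fun n : ℕ => (B n : ℝ) * (S.meanσ.toReal * S.tail ((n : ℝ) ^ L))) =o[atTop]
      fun n : ℕ => S.tail n := by
    have e1 : (fun n : ℕ => S.tail ((n : ℝ) ^ L)) =O[atTop] fun n : ℕ => (n : ℝ) ^ (-L) := by
      refine Asymptotics.IsBigO.of_bound CR ?_
      filter_upwards [eventually_ge_atTop 1] with n hn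
      have hn0 : (0 : ℝ) < n := by exact_mod_cast hn
      rw [Real.norm_of_nonneg (S.tail_nonneg _), Real.norm_of_nonneg (by positivity),
        Real.rpow_neg hn0.le, ← div_eq_mul_inv]
      exact hR _ (by positivity)
    refine (((hBO.mul (e1.const_mul_left _)).trans_eventuallyEq (hmulpow _ _)).trans_isLittleO
      (hpow _ (-a) ?_)).trans_isBigO hO
    linarith
  have o2 : (fun n : ℕ => (B n : ℝ) * ((B n : ℝ) *
      (S.meanσ.toReal * (C * (n : ℝ) ^ (-η) * S.tail n)))) =o[atTop] fun n : ℕ => S.tail n := by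
    have e2 : (fun n : ℕ => (B n : ℝ) * (B n : ℝ) * (n : ℝ) ^ (-η)) =o[atTop]
        fun _ : ℕ => (1 : ℝ) := by
      refine ((((hBO.mul hBO).trans_eventuallyEq (hmulpow _ _)).mul
        (Asymptotics.isBigO_refl _ _)).trans_eventuallyEq (hmulpow _ _)).trans_isLittleO
        ((hpow _ 0 ?_).trans_eventuallyEq ?_)
      · linarith
      · exact Eventually.of_forall fun n => Real.rpow_zero _
    have e3 := (e2.mul_isBigO (Asymptotics.isBigO_refl (fun n : ℕ => S.tail n) atTop)).const_mul_left
      (S.meanσ.toReal * C)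
    refine e3.congr (fun n => ?_) fun n => one_mul _
    ring
  have o3 : (fun n : ℕ => Cσ * (1 - ρ)⁻¹ * ρ ^ B n) =o[atTop] fun n : ℕ => S.tail n :=
    (((isBigO_pow_ceil_rpow hρ hs0 (-(a + 1))).trans_isLittleO
      (hpow _ (-a) (by linarith))).trans_isBigO hO).const_mul_left _
  have o4 := ((o1.add o2).add o3).def (show 0 < S.meanσ.toReal / 2 by positivity)
  refine Asymptotics.IsBigO.of_bound (2 * J / S.meanσ.toReal) ?_
  filter_upwards [o4, eventually_ge_atTop 1,
    (tendsto_natCast_atTop_atTop (R := ℝ)).eventually_ge_atTop v₀] with n h4 hn hv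
  have h5 := S.meanσ_mul_tail_le hρ hCσ.le hσ hκ.1 hJ' hn (B n) (hpairs n hv)
  have h6 := (Real.le_norm_self _).trans h4
  rw [Real.norm_of_nonneg (S.tail_nonneg _)] at h6
  rw [Real.norm_of_nonneg (S.tail_nonneg _), Real.norm_of_nonneg measureReal_nonneg,
    div_mul_eq_mul_div, le_div_iff₀ hmean]
  linarith

end TwoSidedCMZ

theorem mainTheorem1 {M : Type u} [MetricSpace M] [BoundedSpace M] [MeasurableSpace M]
    [BorelSpace M] (T : M → M) (μ : Measure M) [IsProbabilityMeasure μ]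
    (S : TwoSidedCMZ.{u, v} T μ) (hC1 : S.C1)
    (U : Set (Arc M)) (hC2 : S.C2 U)
    (G : ℕ → ℕ → StandardFamily.{u, w} U) (hC3 : S.C3 G) (hG : S.IsImageSequence G)
    (hEquiv : S.UniformlyEquivalent G)
    (t p : ℝ) (hp : 1 < p) (hpt : p ≤ t) (hC4 : S.C4 U t) (hC5 : S.C5 G t p) :
    -- (a)
    (∀ (r : ℝ → ℝ) (α : ℝ), IsRegularlyVarying r α →
      (fun n : ℕ => S.μtower.real (S.H n)) =O[atTop] (fun n : ℕ => r n) →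
      (fun n : ℕ => S.μ₀.real (S.A n)) =O[atTop] (fun n : ℕ => r n)) ∧
    -- (b)
    (∀ a : ℝ, 0 < a →
      (fun n : ℕ => (n : ℝ) ^ (-a)) =O[atTop] (fun n : ℕ => S.μtower.real (S.H n)) →
      (fun n : ℕ => S.μtower.real (S.H n)) =O[atTop] (fun n : ℕ => S.μ₀.real (S.A n))) ∧
    -- (c)
    (∀ (r : ℝ → ℝ) (α : ℝ), IsRegularlyVarying r α →
      (fun n : ℕ => S.μtower.real (S.H n)) =Θ[atTop] (fun n : ℕ => r n) →
      (fun n : ℕ => S.μ₀.real (S.A n)) =Θ[atTop] (fun n : ℕ => r n)) := by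
  obtain ⟨κ, hκ, η, C, v₀, hη, hC, hpairs⟩ :=
    TwoSidedCMZ.exists_measure_pairs_le hC2 hC3 hG hEquiv hp hpt hC4 hC5
  simp only [S.μtower_real_H]
  have upper := fun (r : ℝ → ℝ) (α : ℝ) (hr : IsRegularlyVarying r α) =>
    TwoSidedCMZ.isBigO_measure_A hC1 hκ hη hC hpairs hr
  have lower := fun (a : ℝ) (ha : 0 < a) => TwoSidedCMZ.tail_isBigO hC1 hκ hη hpairs ha
  refine ⟨upper, lower, fun r α hr hΘ => ⟨upper r α hr hΘ.1, ?_⟩⟩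
  exact hΘ.2.trans (lower (|α| + 1) (by positivity) (hr.rpow_isBigO.trans hΘ.2))
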